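/- **Setting.** Let $X=[a,b]$, $Y=[c,d]\subset\mathbb R$ be compact intervals. Let $f:X\times Y\to\mathbb R$ be continuous, convex in $x$ for each fixed $y$, concave in $y$ for each fixed $x$, and satisfy one of the mixed Monge conditions $\partial_{xx}(-\partial_{yy}f)\ge 0$ or $\partial_{xx}(-\partial_{yy}f)\le 0$ in the sense of distributions on the interior of $X\times Y$. **Saddle networks.** For a class $\mathcal C$ of real functions of one real variable (networks on a given compact interval), a *saddle network of order $N$* over $\mathcal C$ is a function $$F(x,y)=\sum_{i=1}^N e_i^{+}(x)\,c_i^{+}(y)+\sum_{i=1}^N e_i^{-}(x)\,a_i^{+}(y)+H(x)+G(y)\qquad (x\in X,\ y\in Y),$$ where $e_i^+\ge 0$, $e_i^-\le 0$ and $H$ are convex on $X$ and belong to $\mathcal C$, $a_i^+\ge 0$ is convex on $Y$ and belongs to $\mathcal C$, and $c_i^+\ge 0$ and $G$ are concave on $Y$ and $-c_i^+,-G\in\mathcal C$. A *bilinear saddle network of order $N$* is a saddle network of order $N$ plus a term $Bxy$ with $B\in\mathbb R$. **Families.** Let $\mathcal C$ be one of the following families with one real input and one real output, of arbitrary depth and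 widths. 1. *ICNNs*: $z_1=\sigma_0(U_0x+b_0)$, $z_{k+1}=\sigma_k(W_kz_k+U_kx+b_k)$ with $W_k\ge0$ entrywise, and output $w^\top z_K+u^\top x+\beta$ with $w\ge 0$, where the activations $\sigma_k$ (applied componentwise) are taken from a set of convex nondecreasing functions $\mathbb R\to\mathbb R$ that contains $\mathrm{ReLU}$. 2. *GroupMax networks* with groups of a fixed size at least $2$: $z_1=\rho(U_0x+b_0)$, $z_{k+1}=\rho(W_kz_k+U_kx+b_k)$ with $W_k\ge 0$ entrywise, where $\rho$ takes the maximum over each group of units, and the output is the last, one-dimensional, $z_K$; either with skip connections ($U_k$ free) or without ($U_k=0$ for $k\ge1$). 3. *P1-ICKANs* on a compact interval: compositions of layers $x\mapsto\bigl(\sum_j\varphi_{ij}(x_j)\bigr)_i$, where the $\varphi_{ij}$ are continuous, piecewise linear and convex, and in all layers but the first also nondecreasing. The $\varphi_{ij}$ live on a finite grid of the input interval (first layer), respectively of the range of the $j$-th output of the preceding layer, known as the interval between the sums of the minima and of the maxima over the grid points of its univariate functions (other layers). Either the grids are free, or they are all uniform. **Claim.** All functions in $\mathcal C$ are convex on their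 input interval; $\mathcal C$ is a universal approximator, in the sup norm, of the continuous convex functions on compact intervals of $\mathbb R$; and for all $X$, $Y$ and $f$ as above and every $\varepsilon>0$ there are $N\ge1$ and a saddle network $F$ of order $N$ over $\mathcal C$, as well as $N'\ge 1$ and a bilinear saddle network $F'$ of order $N'$ over $\mathcal C$, such that $$\sup_{X\times Y}|f-F|<\varepsilon,\qquad \sup_{X\times Y}|f-F'|<\varepsilon .$$ -/

import Mathlib

open Set MeasureTheory

/-! ## Convex-concave functions and the mixed Monge condition -/

/-- `φ` is a nonnegative smooth test function with compact support in `U ⊆ ℝ²`. -/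
def IsNonnegTestFunction (U : Set (ℝ × ℝ)) (φ : ℝ × ℝ → ℝ) : Prop :=
  ContDiff ℝ ((⊤ : ℕ∞) : WithTop ℕ∞) φ ∧ HasCompactSupport φ ∧ tsupport φ ⊆ U ∧ ∀ p, 0 ≤ φ p

/-- The value at the test function `φ` of the distribution `∂xx (-∂yy f)` on `U`,
that is `-∫_U f ∂yy ∂xx φ`. -/
noncomputable def mixedDistribution (U : Set (ℝ × ℝ)) (f : ℝ → ℝ → ℝ) (φ : ℝ × ℝ → ℝ) : ℝ :=
  -∫ p in U, f p.1 p.2 *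
    iteratedDeriv 2 (fun t => iteratedDeriv 2 (fun s => φ (s, t)) p.1) p.2

/-- `∂xx (-∂yy f) ≥ 0` in the sense of distributions (on the interior of `X × Y`). -/
def MongeNonneg (X Y : Set ℝ) (f : ℝ → ℝ → ℝ) : Prop :=
  ∀ φ, IsNonnegTestFunction (interior (X ×ˢ Y)) φ →
    0 ≤ mixedDistribution (interior (X ×ˢ Y)) f φ

/-- `∂xx (-∂yy f) ≤ 0` in the sense of distributions (on the interior of `X × Y`). -/
def MongeNonpos (X Y : Set ℝ) (f : ℝ → ℝ → ℝ) : Prop :=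
  ∀ φ, IsNonnegTestFunction (interior (X ×ˢ Y)) φ →
    mixedDistribution (interior (X ×ˢ Y)) f φ ≤ 0

/-- Continuous convex-concave functions on `X × Y`. -/
def IsConvexConcave (X Y : Set ℝ) (f : ℝ → ℝ → ℝ) : Prop :=
  ContinuousOn (fun p : ℝ × ℝ => f p.1 p.2) (X ×ˢ Y) ∧
  (∀ y ∈ Y, ConvexOn ℝ X (fun x => f x y)) ∧
  (∀ x ∈ X, ConcaveOn ℝ Y (fun y => f x y))

/-! ## Network classes and saddle networks -/

/-- A class of scalar networks with one real input: `C a b` is the set of the functions that the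
networks of the class with input domain `[a, b]` realize.  (Some architectures are built on a grid
of their input domain, so the class may depend on it.)  Only the values on `[a, b]` matter. -/
abbrev NetworkClass := ℝ → ℝ → Set (ℝ → ℝ)

/-- Every network of the class is a convex function on its input domain. -/
def ConvexityPreserving (C : NetworkClass) : Prop :=
  ∀ a b, a ≤ b → ∀ g ∈ C a b, ConvexOn ℝ (Icc a b) g

/-- Universal approximation of continuous convex functions on compact intervals, in sup norm. -/
def UniversalConvexApproximator (C : NetworkClass) : Prop :=
  ∀ a b, a ≤ b → ∀ g : ℝ → ℝ, ContinuousOn g (Icc a b) → ConvexOn ℝ (Icc a b) g →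
    ∀ ε > 0, ∃ n ∈ C a b, ∀ x ∈ Icc a b, |g x - n x| < ε

/-- Saddle networks of order `N` on `X × Y`: the members of the saddle class of order `N`
(`e⁺`, `e⁻`, `a⁺`, `H` convex, `c⁺`, `G` concave, with `e⁺, c⁺, a⁺ ≥ 0` and `e⁻ ≤ 0`) all of
whose convex components are networks, and all of whose concave components are negatives of
networks; the networks are taken from `CX` in the variable `x` and from `CY` in `y`. -/
def saddleNetworks (CX CY : Set (ℝ → ℝ)) (X Y : Set ℝ) (N : ℕ) : Set (ℝ → ℝ → ℝ) :=
  {F | ∃ (ePos eNeg cPos aPos : Fin N → ℝ → ℝ) (H G : ℝ → ℝ),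
    (∀ i, ePos i ∈ CX ∧ ConvexOn ℝ X (ePos i) ∧ ∀ x ∈ X, 0 ≤ ePos i x) ∧
    (∀ i, eNeg i ∈ CX ∧ ConvexOn ℝ X (eNeg i) ∧ ∀ x ∈ X, eNeg i x ≤ 0) ∧
    (∀ i, -cPos i ∈ CY ∧ ConcaveOn ℝ Y (cPos i) ∧ ∀ y ∈ Y, 0 ≤ cPos i y) ∧
    (∀ i, aPos i ∈ CY ∧ ConvexOn ℝ Y (aPos i) ∧ ∀ y ∈ Y, 0 ≤ aPos i y) ∧
    (H ∈ CX ∧ ConvexOn ℝ X H) ∧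
    (-G ∈ CY ∧ ConcaveOn ℝ Y G) ∧
    ∀ x ∈ X, ∀ y ∈ Y,
      F x y = ∑ i, ePos i x * cPos i y + ∑ i, eNeg i x * aPos i y + H x + G y}

/-- Bilinear saddle networks of order `N`: a saddle network of order `N` plus a bilinear term. -/
def bilinearSaddleNetworks (CX CY : Set (ℝ → ℝ)) (X Y : Set ℝ) (N : ℕ) : Set (ℝ → ℝ → ℝ) :=
  {F | ∃ g ∈ saddleNetworks CX CY X Y N, ∃ B : ℝ,
    ∀ x ∈ X, ∀ y ∈ Y, F x y = g x y + x * B * y}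

/-! ## Input convex neural networks (ICNN) -/

/-- The rectified linear unit. -/
noncomputable def relu (t : ℝ) : ℝ := max t 0

/-- The maps `ℝ^d → ℝ^n` computed by the last hidden layer of an ICNN with activations in `A`:
`z₁ = σ₀ (U₀ x + b₀)`, `z_{k+1} = σ_k (W_k z_k + U_k x + b_k)` with `W_k ≥ 0` entrywise. -/
inductive IsICNNHidden (A : Set (ℝ → ℝ)) (d : ℕ) :
    (n : ℕ) → ((Fin d → ℝ) → Fin n → ℝ) → Prop
  | first (n : ℕ) (σ : ℝ → ℝ) (hσ : σ ∈ A) (U : Matrix (Fin n) (Fin d) ℝ) (b : Fin n → ℝ) :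
      IsICNNHidden A d n (fun x i => σ ((U.mulVec x + b) i))
  | next (m n : ℕ) (z : (Fin d → ℝ) → Fin m → ℝ) (hz : IsICNNHidden A d m z)
      (σ : ℝ → ℝ) (hσ : σ ∈ A) (W : Matrix (Fin n) (Fin m) ℝ) (hW : ∀ i j, 0 ≤ W i j)
      (U : Matrix (Fin n) (Fin d) ℝ) (b : Fin n → ℝ) :
      IsICNNHidden A d n (fun x i => σ ((W.mulVec (z x) + U.mulVec x + b) i))

/-- `f : ℝ^d → ℝ` is an ICNN: an affine output layer, with nonnegative weights on the hidden
units and free weights on the input. -/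
def IsICNN (A : Set (ℝ → ℝ)) (d : ℕ) (f : (Fin d → ℝ) → ℝ) : Prop :=
  ∃ (m : ℕ) (z : (Fin d → ℝ) → Fin m → ℝ) (w : Fin m → ℝ) (u : Fin d → ℝ) (c : ℝ),
    IsICNNHidden A d m z ∧ (∀ j, 0 ≤ w j) ∧ ∀ x, f x = w ⬝ᵥ z x + u ⬝ᵥ x + c

/-- ICNNs with one real input. -/
def icnnClass (A : Set (ℝ → ℝ)) : NetworkClass := fun _ _ =>
  {g | ∃ f, IsICNN A 1 f ∧ ∀ t, g t = f (fun _ => t)}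

/-! ## GroupMax networks -/

/-- The GroupMax activation: the maximum over each of `n` groups of `k` units. -/
noncomputable def groupMax {n k : ℕ} (v : Fin n × Fin k → ℝ) : Fin n → ℝ :=
  fun i => ⨆ j : Fin k, v (i, j)

/-- The maps `ℝ^d → ℝ^n` computed by GroupMax networks with groups of size `k`:
`z₁ = ρ (U₀ x + b₀)`, `z_{l+1} = ρ (W_l z_l + U_l x + b_l)` with `W_l ≥ 0` entrywise and `ρ` the
GroupMax activation.  If `skip` is `false`, there are no skip connections from the input
(`U_l = 0` for `l ≥ 1`). -/
inductive IsGroupMaxLayer (k : ℕ) (skip : Bool) (d : ℕ) :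
    (n : ℕ) → ((Fin d → ℝ) → Fin n → ℝ) → Prop
  | first (n : ℕ) (U : Matrix (Fin n × Fin k) (Fin d) ℝ) (b : Fin n × Fin k → ℝ) :
      IsGroupMaxLayer k skip d n (fun x => groupMax (U.mulVec x + b))
  | next (m n : ℕ) (z : (Fin d → ℝ) → Fin m → ℝ) (hz : IsGroupMaxLayer k skip d m z)
      (W : Matrix (Fin n × Fin k) (Fin m) ℝ) (hW : ∀ i j, 0 ≤ W i j)
      (U : Matrix (Fin n × Fin k) (Fin d) ℝ) (hU : skip = true ∨ U = 0)
      (b : Fin n × Fin k → ℝ) :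
      IsGroupMaxLayer k skip d n (fun x => groupMax (W.mulVec (z x) + U.mulVec x + b))

/-- GroupMax networks with one real input and one output. -/
def groupMaxClass (k : ℕ) (skip : Bool) : NetworkClass := fun _ _ =>
  {g | ∃ z, IsGroupMaxLayer k skip 1 1 z ∧ ∀ t, g t = z (fun _ => t) 0}

/-! ## P1-ICKAN -/

/-- The continuous piecewise linear function with knots `k₀ ≤ ⋯ ≤ k_P`, with value `c` at `k₀`
and slope `s_p` on `[k_p, k_{p+1}]` (constant to the left of `k₀` and to the right of `k_P`). -/
noncomputable def p1Spline {P : ℕ} (k : Fin (P + 1) → ℝ) (c : ℝ) (s : Fin P → ℝ) (t : ℝ) : ℝ :=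
  c + ∑ p : Fin P, s p * (min (max t (k p.castSucc)) (k p.succ) - k p.castSucc)

/-- A P1-ICKAN layer `ℝ^m → ℝ^n` on the box `∏ [lo j, hi j]`: a grid of `P` meshes of each
`[lo j, hi j]`, and for each pair `(i, j)` a convex piecewise linear function on the `j`-th grid
(its slopes are nondecreasing). -/
structure P1Layer (m n : ℕ) (lo hi : Fin m → ℝ) where
  P : ℕ
  P_pos : 0 < P
  knot : Fin m → Fin (P + 1) → ℝ
  knot_mono : ∀ j, Monotone (knot j)
  knot_first : ∀ j, knot j 0 = lo j
  knot_last : ∀ j, knot j (Fin.last P) = hi j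
  offset : Fin n → Fin m → ℝ
  slope : Fin n → Fin m → Fin P → ℝ
  slope_mono : ∀ i j, Monotone (slope i j)

namespace P1Layer

variable {m n : ℕ} {lo hi : Fin m → ℝ}

/-- The univariate function from the `j`-th input to the `i`-th output. -/
noncomputable def phi (L : P1Layer m n lo hi) (i : Fin n) (j : Fin m) : ℝ → ℝ :=
  p1Spline (L.knot j) (L.offset i j) (L.slope i j)

/-- The map of the layer: `x ↦ (∑ j, φ_{ij}(x_j))_i`. -/
noncomputable def eval (L : P1Layer m n lo hi) (x : Fin m → ℝ) (i : Fin n) : ℝ :=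
  ∑ j, L.phi i j (x j)

/-- The lower end of the known range of each output, computed from the values at the knots. -/
noncomputable def outLo (L : P1Layer m n lo hi) (i : Fin n) : ℝ :=
  ∑ j, ⨅ p : Fin (L.P + 1), L.phi i j (L.knot j p)

/-- The upper end of the known range of each output, computed from the values at the knots. -/
noncomputable def outHi (L : P1Layer m n lo hi) (i : Fin n) : ℝ :=
  ∑ j, ⨆ p : Fin (L.P + 1), L.phi i j (L.knot j p)

/-- All grids of the layer are uniform. -/
def Uniform (L : P1Layer m n lo hi) : Prop :=
  ∀ j p, L.knot j p = lo j + ((p : ℕ) : ℝ) / (L.P : ℝ) * (hi j - lo j)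

/-- All univariate functions of the layer are nondecreasing. -/
def Nondecreasing (L : P1Layer m n lo hi) : Prop :=
  ∀ i j p, 0 ≤ L.slope i j p

end P1Layer

/-- `IsP1ICKAN adaptive lo hi n lo' hi' z`: the map `z : ℝ^d → ℝ^n` is a P1-ICKAN on the box
`∏ [lo j, hi j]`, with known output range `∏ [lo' i, hi' i]`.  It is a composition of layers, the
first with convex and the following ones with convex nondecreasing univariate functions, each layer
built on a grid of the known range of the preceding one.  The grids are free (trainable) if
`adaptive` is `true`, uniform if it is `false`. -/
inductive IsP1ICKAN (adaptive : Bool) {d : ℕ} (lo hi : Fin d → ℝ) :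
    (n : ℕ) → (Fin n → ℝ) → (Fin n → ℝ) → ((Fin d → ℝ) → Fin n → ℝ) → Prop
  | first (n : ℕ) (L : P1Layer d n lo hi) (hL : adaptive = true ∨ L.Uniform) :
      IsP1ICKAN adaptive lo hi n L.outLo L.outHi L.eval
  | next (m n : ℕ) (lo' hi' : Fin m → ℝ) (z : (Fin d → ℝ) → Fin m → ℝ)
      (hz : IsP1ICKAN adaptive lo hi m lo' hi' z)
      (L : P1Layer m n lo' hi') (hL : adaptive = true ∨ L.Uniform) (hmono : L.Nondecreasing) :
      IsP1ICKAN adaptive lo hi n L.outLo L.outHi (fun x => L.eval (z x))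

/-- P1-ICKANs on the input domain `[a, b]` with one real output. -/
def p1ICKANClass (adaptive : Bool) : NetworkClass := fun a b =>
  {g | ∃ lo' hi' z, IsP1ICKAN adaptive (fun _ : Fin 1 => a) (fun _ => b) 1 lo' hi' z ∧
    ∀ t, g t = z (fun _ => t) 0}

/-! ## The concrete families -/

/-- The concrete convex network families: ICNNs with activations in any set of convex
nondecreasing functions that contains ReLU; GroupMax networks of any group size at least two, with
or without skip connections from the input; P1-ICKANs, with adaptive or with uniform grids. -/
def IsConcreteFamily (C : NetworkClass) : Prop :=
  (∃ A : Set (ℝ → ℝ), relu ∈ A ∧ (∀ σ ∈ A, ConvexOn ℝ univ σ ∧ Monotone σ) ∧ C = icnnClass A) ∨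
  (∃ (k : ℕ) (skip : Bool), 2 ≤ k ∧ C = groupMaxClass k skip) ∨
  (∃ adaptive : Bool, C = p1ICKANClass adaptive)

/-! ## Piecewise linear splines -/

section Spline

variable {P : ℕ} {k : Fin (P + 1) → ℝ}

/-! Suppose first that `∂xx (-∂yy f) ≥ 0`. For fixed `x`, interpolate `f x` piecewise linearly on a
fine uniform grid of `[c, d]`. The interpolant is the chord plus a sum of Green kernels of `-∂yy`
with Dirichlet conditions (`p1Spline_chordSlope_eq_green`). The kernels are nonnegative and concave
in `y`. Their coefficients are scaled negative second differences of `f x`: nonnegative because `f`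
is concave in `y`, and convex in `x` by the Monge condition. The chord has the coefficients `f x c`
and `f x d`, convex in `x`, which become nonnegative after adding a bound `M` of `|f|`; since the
two affine weights sum to one, this only shifts the sum by `M`. So `f` is, up to a constant, a
uniform limit of sums of nonnegative convex times nonnegative concave functions
(`exists_convex_mul_concave_near`).

If the sign is reversed, the same applies to `(y, x) ↦ -f x y`, and negating the result gives
nonpositive convex functions of `x` times nonnegative convex functions of `y`. Hence each sign needs
only one of the two sums of a saddle network, and no bilinear term.

Two supports remain. The distributional condition has to be made pointwise: it is tested with
products `A(x) B(y)`, where `A''` is a second difference of narrow bumps, one variable at a time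
(`convexOn_of_forall_testFunction`, `mongeDifference_of_continuous`). And the factors have to be
replaced by networks: products depend continuously on their factors, and a small shift before
approximating preserves the signs (`exists_saddleNetwork_near`). For this the families only need to
be convex and universal; universality again comes from linear interpolation, which for a convex
function is affine plus nonnegative multiples of ramps. -/

theorem p1Spline_eq_of_mem_piece (hk : Monotone k) (c : ℝ) (s : Fin P → ℝ) (p : Fin P) {t : ℝ}
    (ht : t ∈ Icc (k p.castSucc) (k p.succ)) :
    p1Spline k c s t = p1Spline k c s (k p.castSucc) + s p * (t - k p.castSucc) := by
  have hterm : ∀ q : Fin P, s q * (min (max t (k q.castSucc)) (k q.succ) - k q.castSucc) =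
      s q * (min (max (k p.castSucc) (k q.castSucc)) (k q.succ) - k q.castSucc) +
        if q = p then s p * (t - k p.castSucc) else 0 := by
    intro q
    -- Meshes to the left of mesh `p` are saturated and those to the right contribute nothing, both
    -- at `t` and at the left knot; only mesh `p` itself sees the difference.
    rcases lt_trichotomy q p with h | h | h
    · have h1 : k q.succ ≤ k p.castSucc := hk (Fin.succ_le_castSucc_iff.2 h)
      rw [if_neg h.ne, min_eq_right (le_max_of_le_left (h1.trans ht.1)),
        min_eq_right (le_max_of_le_left h1), add_zero]
    · subst h
      rw [if_pos rfl, max_eq_left ht.1, min_eq_left ht.2, max_self,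
        min_eq_left (ht.1.trans ht.2)]
      ring
    · have h1 : k p.succ ≤ k q.castSucc := hk (Fin.succ_le_castSucc_iff.2 h)
      rw [if_neg h.ne', max_eq_right (ht.2.trans h1),
        max_eq_right ((ht.1.trans ht.2).trans h1), add_zero]
  simp only [p1Spline, hterm, Finset.sum_add_distrib, Finset.sum_ite_eq', Finset.mem_univ, if_true]
  ring

theorem p1Spline_first_knot (hk : Monotone k) (c : ℝ) (s : Fin P → ℝ) :
    p1Spline k c s (k 0) = c := by
  have : ∀ q : Fin P, s q * (min (max (k 0) (k q.castSucc)) (k q.succ) - k q.castSucc) = 0 := by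
    intro q
    rw [max_eq_right (hk (Fin.zero_le _)), min_eq_left (hk (Fin.castSucc_le_succ q))]
    ring
  simp [p1Spline, this]

theorem p1Spline_succ_knot (hk : Monotone k) (c : ℝ) (s : Fin P → ℝ) (p : Fin P) :
    p1Spline k c s (k p.succ) =
      p1Spline k c s (k p.castSucc) + s p * (k p.succ - k p.castSucc) :=
  p1Spline_eq_of_mem_piece hk c s p ⟨hk (Fin.castSucc_le_succ p), le_rfl⟩

theorem exists_mem_piece (hP : 0 < P) {t : ℝ} (ht : t ∈ Icc (k 0) (k (Fin.last P))) :
    ∃ p : Fin P, t ∈ Icc (k p.castSucc) (k p.succ) := by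
  by_contra! h
  -- If no mesh contains `t`, then `t` can never be overtaken by a knot; the last mesh gives the
  -- contradiction.
  have key : ∀ j : Fin (P + 1), k j ≤ t := by
    intro j
    induction j using Fin.induction with
    | zero => exact ht.1
    | succ p ih =>
      by_contra! hlt
      exact h p ⟨ih, hlt.le⟩
  obtain ⟨n, rfl⟩ : ∃ n, P = n + 1 := ⟨P - 1, by omega⟩
  refine h (Fin.last n) ⟨key _, ?_⟩
  rw [Fin.succ_last]
  exact ht.2

/-- On its grid interval a spline lies between the extreme values at its knots. -/
theorem p1Spline_mem_Icc_knots (hP : 0 < P) (hk : Monotone k) (c : ℝ) (s : Fin P → ℝ) {t : ℝ}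
    (ht : t ∈ Icc (k 0) (k (Fin.last P))) :
    p1Spline k c s t ∈ Icc (⨅ p, p1Spline k c s (k p)) (⨆ p, p1Spline k c s (k p)) := by
  obtain ⟨p, hp⟩ := exists_mem_piece hP ht
  have hlo : ∀ q, ⨅ p, p1Spline k c s (k p) ≤ p1Spline k c s (k q) :=
    fun q => ciInf_le (Set.finite_range _).bddBelow q
  have hhi : ∀ q, p1Spline k c s (k q) ≤ ⨆ p, p1Spline k c s (k p) :=
    fun q => le_ciSup (f := fun p => p1Spline k c s (k p)) (Set.finite_range _).bddAbove q
  have e1 := p1Spline_eq_of_mem_piece hk c s p hp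
  have e2 := p1Spline_succ_knot hk c s p
  have l1 := hlo p.castSucc
  have l2 := hlo p.succ
  have u1 := hhi p.castSucc
  have u2 := hhi p.succ
  rcases le_total 0 (s p) with h | h
  · have := mul_le_mul_of_nonneg_left (sub_le_sub_right hp.2 (k p.castSucc)) h
    have := mul_nonneg h (sub_nonneg.2 hp.1)
    constructor <;> linarith
  · have := mul_le_mul_of_nonpos_left (sub_le_sub_right hp.2 (k p.castSucc)) h
    have := mul_nonpos_of_nonpos_of_nonneg h (sub_nonneg.2 hp.1)
    constructor <;> linarith

/-- Lets the defining sum of a spline be summed by parts. -/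
theorem clamp_sub_eq {x y t : ℝ} (h : x ≤ y) :
    min (max t x) y - x = max (t - x) 0 - max (t - y) 0 := by
  rcases le_total t x with h1 | h1 <;> rcases le_total t y with h2 | h2
  · rw [max_eq_right h1, min_eq_left h, max_eq_right (by linarith), max_eq_right (by linarith)]
    ring
  · rw [max_eq_right h1, min_eq_left h, max_eq_right (by linarith), max_eq_left (by linarith)]
    linarith
  · rw [max_eq_left h1, min_eq_left h2, max_eq_left (by linarith), max_eq_right (by linarith)]
    ring
  · rw [max_eq_left h1, min_eq_right h2, max_eq_left (by linarith), max_eq_left (by linarith)]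
    ring

/-- On its grid interval a spline is an affine function plus ramps at the inner knots, weighted by
the jumps of the slope. -/
theorem p1Spline_eq_sum_ramps {n : ℕ} {k : Fin (n + 2) → ℝ} (hk : Monotone k) (c : ℝ)
    (s : Fin (n + 1) → ℝ) {t : ℝ} (ht : t ∈ Icc (k 0) (k (Fin.last (n + 1)))) :
    p1Spline k c s t = c + s 0 * (t - k 0) +
      ∑ p : Fin n, (s p.succ - s p.castSucc) * max (t - k p.succ.castSucc) 0 := by
  have h : ∀ p : Fin (n + 1), s p * (min (max t (k p.castSucc)) (k p.succ) - k p.castSucc) =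
      s p * max (t - k p.castSucc) 0 - s p * max (t - k p.succ) 0 := by
    intro p
    rw [clamp_sub_eq (hk (Fin.castSucc_le_succ p))]
    ring
  simp only [p1Spline, h, Finset.sum_sub_distrib]
  -- Abel summation. The ramp at the first knot and the ramp at the last knot are split off; on the
  -- grid interval the former is affine and the latter vanishes.
  rw [Fin.sum_univ_succ (fun p : Fin (n + 1) => s p * max (t - k p.castSucc) 0),
    Fin.sum_univ_castSucc (fun p : Fin (n + 1) => s p * max (t - k p.succ) 0)]
  simp only [Fin.castSucc_zero, Fin.succ_last, sub_mul, Finset.sum_sub_distrib, Fin.succ_castSucc]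
  rw [max_eq_left (by linarith [ht.1] : 0 ≤ t - k 0),
    max_eq_right (by linarith [ht.2] : t - k (Fin.last (n + 1)) ≤ 0)]
  ring

theorem convexOn_ramp (S : Set ℝ) (hS : Convex ℝ S) (u : ℝ) :
    ConvexOn ℝ S (fun t => max (t - u) 0) :=
  ((convexOn_id hS).add_const (-u)).sup (convexOn_const 0 hS)

theorem convexOn_finset_sum {ι E : Type*} [AddCommGroup E] [Module ℝ E] {S : Set E}
    (hS : Convex ℝ S) (s : Finset ι) {f : ι → E → ℝ} (hf : ∀ i ∈ s, ConvexOn ℝ S (f i)) :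
    ConvexOn ℝ S (fun x => ∑ i ∈ s, f i x) := by
  classical
  induction s using Finset.induction_on with
  | empty => simpa using convexOn_const 0 hS
  | insert i s hi ih =>
    simp only [Finset.sum_insert hi]
    exact (hf i (Finset.mem_insert_self _ _)).add
      (ih fun j hj => hf j (Finset.mem_insert_of_mem hj))

/-- The slope jumps that weight the ramps are nonnegative. Beyond the grid the spline is constant,
so convexity can fail there; this is why deeper P1-ICKAN layers need control of ranges. -/
theorem convexOn_p1Spline (hP : 0 < P) (hk : Monotone k) (c : ℝ) {s : Fin P → ℝ}
    (hs : Monotone s) : ConvexOn ℝ (Icc (k 0) (k (Fin.last P))) (p1Spline k c s) := by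
  obtain ⟨n, rfl⟩ : ∃ n, P = n + 1 := ⟨P - 1, by omega⟩
  refine ConvexOn.congr ?_ (fun t ht => (p1Spline_eq_sum_ramps hk c s ht).symm)
  have hS := convex_Icc (𝕜 := ℝ) (k 0) (k (Fin.last (n + 1)))
  refine ConvexOn.add ?_ (convexOn_finset_sum hS _ fun p _ => ?_)
  · refine ⟨hS, fun x _ y _ α β _ _ h => le_of_eq ?_⟩
    simp only [smul_eq_mul]
    linear_combination (s 0 * k 0 - c) * h
  · exact (convexOn_ramp _ hS _).smul
      (sub_nonneg.2 (hs (Fin.castSucc_le_succ p)))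

theorem monotone_p1Spline (c : ℝ) {s : Fin P → ℝ} (hs : ∀ p, 0 ≤ s p) :
    Monotone (p1Spline k c s) := by
  intro x y hxy
  unfold p1Spline
  gcongr with p
  exact hs p

end Spline

/-! ## Interpolation on uniform grids -/

/-- The uniform grid of `n + 1` meshes of `[a, b]`. -/
noncomputable def uniformKnot (a b : ℝ) (n : ℕ) (p : Fin (n + 2)) : ℝ :=
  a + ((p : ℕ) : ℝ) / ((n + 1 : ℕ) : ℝ) * (b - a)

/-- The slopes of the chords of `g` over the meshes of a grid. -/
noncomputable def chordSlope {P : ℕ} (k : Fin (P + 1) → ℝ) (g : ℝ → ℝ) (p : Fin P) : ℝ :=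
  (g (k p.succ) - g (k p.castSucc)) / (k p.succ - k p.castSucc)

section Interpolation

variable {a b : ℝ}

theorem uniformKnot_zero (a b : ℝ) (n : ℕ) : uniformKnot a b n 0 = a := by simp [uniformKnot]

theorem uniformKnot_last (a b : ℝ) (n : ℕ) : uniformKnot a b n (Fin.last (n + 1)) = b := by
  have : ((n : ℝ) + 1) ≠ 0 := by positivity
  simp [uniformKnot, div_self this]

theorem uniformKnot_mono (hab : a ≤ b) (n : ℕ) : Monotone (uniformKnot a b n) := by
  intro p q hpq
  unfold uniformKnot
  have : ((p : ℕ) : ℝ) ≤ ((q : ℕ) : ℝ) := by exact_mod_cast hpq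
  have := sub_nonneg.2 hab
  gcongr

theorem uniformKnot_mem (hab : a ≤ b) (n : ℕ) (p : Fin (n + 2)) :
    uniformKnot a b n p ∈ Icc a b :=
  ⟨by simpa [uniformKnot_zero] using uniformKnot_mono hab n (Fin.zero_le p),
    by simpa [uniformKnot_last] using uniformKnot_mono hab n (Fin.le_last p)⟩

theorem uniformKnot_succ_sub (a b : ℝ) (n : ℕ) (p : Fin (n + 1)) :
    uniformKnot a b n p.succ - uniformKnot a b n p.castSucc = (b - a) / (n + 1) := by
  simp only [uniformKnot, Fin.val_succ, Fin.val_castSucc]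
  push_cast
  ring

theorem exists_uniformKnot_mesh_lt (a b : ℝ) {δ : ℝ} (hδ : 0 < δ) :
    ∃ n : ℕ, (b - a) / (n + 1) < δ := by
  obtain ⟨n, hn⟩ := exists_nat_gt ((b - a) / δ)
  refine ⟨n, ?_⟩
  rw [div_lt_iff₀ hδ] at hn
  rw [div_lt_iff₀ (by positivity)]
  nlinarith

theorem p1Spline_chordSlope_knot {P : ℕ} {k : Fin (P + 1) → ℝ} (hk : Monotone k) (g : ℝ → ℝ)
    (j : Fin (P + 1)) : p1Spline k (g (k 0)) (chordSlope k g) (k j) = g (k j) := by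
  induction j using Fin.induction with
  | zero => exact p1Spline_first_knot hk _ _
  | succ p ih =>
    rw [p1Spline_succ_knot hk, ih, chordSlope]
    -- Coincident knots are allowed: division by zero gives slope `0`, and the two values agree
    -- anyway.
    rcases eq_or_ne (k p.succ) (k p.castSucc) with h | h
    · simp [h]
    · rw [div_mul_cancel₀ _ (sub_ne_zero.2 h)]
      ring

/-- The interpolating spline is as close to `g` as `g` oscillates over the meshes. -/
theorem abs_p1Spline_chordSlope_sub_le {P : ℕ} {k : Fin (P + 1) → ℝ} (hP : 0 < P)
    (hk : Monotone k) (g : ℝ → ℝ) {ε t : ℝ} (ht : t ∈ Icc (k 0) (k (Fin.last P)))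
    (hg : ∀ p : Fin P, t ∈ Icc (k p.castSucc) (k p.succ) →
      ∀ u ∈ Icc (k p.castSucc) (k p.succ), |g u - g t| ≤ ε) :
    |p1Spline k (g (k 0)) (chordSlope k g) t - g t| ≤ ε := by
  obtain ⟨p, hp⟩ := exists_mem_piece hP ht
  have hle : k p.castSucc ≤ k p.succ := hp.1.trans hp.2
  have h1 := hg p hp _ ⟨le_rfl, hle⟩
  have h2 := hg p hp _ ⟨hle, le_rfl⟩
  rw [p1Spline_eq_of_mem_piece hk _ _ p hp, p1Spline_chordSlope_knot hk, chordSlope]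
  rcases hle.eq_or_lt with h | h
  · simpa [← h] using h1
  · have hpos := sub_pos.2 h
    -- The spline at `t` is the convex combination, with weight `θ`, of two knot values that are
    -- both within `ε` of `g t`.
    set θ := (t - k p.castSucc) / (k p.succ - k p.castSucc) with hθ
    have h0 : 0 ≤ θ := div_nonneg (sub_nonneg.2 hp.1) hpos.le
    have h1' : θ ≤ 1 := (div_le_one hpos).2 (sub_le_sub_right hp.2 _)
    have e : (g (k p.succ) - g (k p.castSucc)) / (k p.succ - k p.castSucc) * (t - k p.castSucc) =
        θ * (g (k p.succ) - g (k p.castSucc)) := by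
      rw [hθ]; ring
    rw [e]
    rw [abs_le] at h1 h2 ⊢
    constructor <;> nlinarith

theorem chordSlope_uniformKnot_mono (hab : a ≤ b) {g : ℝ → ℝ} (hg : ConvexOn ℝ (Icc a b) g)
    (n : ℕ) : Monotone (chordSlope (uniformKnot a b n) g) := by
  rcases hab.eq_or_lt with rfl | hlt
  · intro p q _
    simp [chordSlope, uniformKnot]
  · rw [Fin.monotone_iff_le_succ]
    intro p
    have hh : 0 < (b - a) / (n + 1) := div_pos (sub_pos.2 hlt) (by positivity)
    refine hg.slope_mono_adjacent (uniformKnot_mem hab n _) (uniformKnot_mem hab n _) ?_ ?_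
    · have := uniformKnot_succ_sub a b n p.castSucc
      linarith
    · have := uniformKnot_succ_sub a b n p.succ
      rw [Fin.succ_castSucc]
      linarith

end Interpolation

/-! ## Distributional and pointwise mixed convexity -/

section Distribution

open Filter Topology

/-- The primitive of `g` that vanishes at `u`. -/
noncomputable def primitiveFrom (u : ℝ) (g : ℝ → ℝ) (s : ℝ) : ℝ := ∫ v in u..s, g v

theorem hasDerivAt_primitiveFrom (u : ℝ) {g : ℝ → ℝ} (hg : Continuous g) (s : ℝ) :
    HasDerivAt (primitiveFrom u g) (g s) s :=
  intervalIntegral.integral_hasDerivAt_right (hg.intervalIntegrable _ _)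
    (hg.stronglyMeasurableAtFilter _ _) hg.continuousAt

theorem contDiff_primitiveFrom (u : ℝ) {g : ℝ → ℝ}
    (hg : ContDiff ℝ ((⊤ : ℕ∞) : WithTop ℕ∞) g) :
    ContDiff ℝ ((⊤ : ℕ∞) : WithTop ℕ∞) (primitiveFrom u g) := by
  rw [contDiff_infty_iff_deriv]
  have h := hasDerivAt_primitiveFrom u hg.continuous
  refine ⟨fun s => (h s).differentiableAt, ?_⟩
  rwa [show deriv (primitiveFrom u g) = g from funext fun s => (h s).deriv]

/-- A smooth convex function that is a smoothing of `s ↦ max s 0` at scale `δ`, together with its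
second derivative, a normalized bump function.  Beyond the scale it is affine. -/
theorem exists_smooth_ramp (φ : ContDiffBump (0 : ℝ)) :
    ∃ E : ℝ → ℝ, ∃ κ : ℝ, ContDiff ℝ ((⊤ : ℕ∞) : WithTop ℕ∞) E ∧ ConvexOn ℝ univ E ∧
      iteratedDeriv 2 E = φ.normed volume ∧ (∀ s ≤ -φ.rOut, E s = 0) ∧
      ∀ s ≥ φ.rOut, E s = s + κ := by
  set η := φ.normed volume with hη
  set r := φ.rOut with hr
  have hr0 : 0 < r := φ.rOut_pos
  have hηc : ContDiff ℝ ((⊤ : ℕ∞) : WithTop ℕ∞) η := φ.contDiff_normed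
  have hη0 : ∀ s, r ≤ |s| → η s = 0 := by
    intro s hs
    rw [← Function.notMem_support, hη, φ.support_normed_eq]
    simpa using hs
  -- `E₁` is a smoothed Heaviside function and its primitive `E` the smoothed ramp; beyond `r` the
  -- slope is exactly `1`, whence the constant `E r - r`.
  set E₁ := primitiveFrom (-r) η with hE₁
  have hE₁d := hasDerivAt_primitiveFrom (-r) hηc.continuous
  have hE₁c : ContDiff ℝ ((⊤ : ℕ∞) : WithTop ℕ∞) E₁ := contDiff_primitiveFrom _ hηc
  have hE₁left : ∀ s ≤ -r, E₁ s = 0 := by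
    intro s hs
    rw [hE₁, primitiveFrom]
    refine intervalIntegral.integral_zero_ae (ae_of_all _ fun v hv => hη0 v ?_)
    rw [uIoc_of_ge hs] at hv
    rw [abs_of_nonpos (by linarith [hv.2])]
    linarith [hv.2]
  have hE₁right : ∀ s ≥ r, E₁ s = 1 := by
    intro s hs
    rw [hE₁, primitiveFrom, intervalIntegral.integral_of_le (by linarith),
      setIntegral_eq_integral_of_forall_compl_eq_zero]
    · exact φ.integral_normed
    · intro v hv
      refine hη0 v ?_
      rw [mem_Ioc, not_and_or, not_lt, not_le] at hv
      rcases hv with hv | hv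
      · rw [abs_of_nonpos (by linarith)]
        linarith
      · rw [abs_of_nonneg (by linarith)]
        linarith
  set E := primitiveFrom (-r) E₁ with hE
  have hEd := hasDerivAt_primitiveFrom (-r) hE₁c.continuous
  have hderivE : deriv E = E₁ := funext fun s => (hEd s).deriv
  have hderivE₁ : deriv E₁ = η := funext fun s => (hE₁d s).deriv
  refine ⟨E, E r - r, contDiff_primitiveFrom _ hE₁c, ?_, ?_, ?_, ?_⟩
  · refine convexOn_univ_of_deriv2_nonneg (fun s => (hEd s).differentiableAt) ?_ ?_
    · rw [hderivE]
      exact fun s => (hE₁d s).differentiableAt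
    · intro s
      simp only [Function.iterate_succ, Function.iterate_zero, Function.comp, id, hderivE, hderivE₁]
      exact φ.nonneg_normed s
  · rw [iteratedDeriv_succ, iteratedDeriv_one, hderivE, hderivE₁]
  · intro s hs
    rw [hE, primitiveFrom]
    refine intervalIntegral.integral_zero_ae (ae_of_all _ fun v hv => hE₁left v ?_)
    rw [uIoc_of_ge hs] at hv
    exact hv.2
  · intro s hs
    have h1 : E s - E r = ∫ v in r..s, E₁ v :=
      (intervalIntegral.integral_interval_sub_left (hE₁c.continuous.intervalIntegrable _ _)
        (hE₁c.continuous.intervalIntegrable _ _))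
    have h2 : ∫ v in r..s, E₁ v = ∫ v in r..s, (1 : ℝ) := by
      refine intervalIntegral.integral_congr fun v hv => hE₁right v ?_
      rw [uIcc_of_le hs] at hv
      exact hv.1
    rw [h2, intervalIntegral.integral_const, smul_eq_mul, mul_one] at h1
    linarith

/-- `A` is a nonnegative smooth test function on the open interval `(a, b)`. -/
def IsNonnegTestFunctionOn (a b : ℝ) (A : ℝ → ℝ) : Prop :=
  ContDiff ℝ ((⊤ : ℕ∞) : WithTop ℕ∞) A ∧ HasCompactSupport A ∧ tsupport A ⊆ Ioo a b ∧ ∀ s, 0 ≤ A s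

theorem iteratedDeriv_two_comp_sub_const {E : ℝ → ℝ} (u : ℝ) :
    iteratedDeriv 2 (fun s => E (s - u)) = fun s => iteratedDeriv 2 E (s - u) :=
  iteratedDeriv_comp_sub_const 2 E u

/-- Test functions whose second derivative is a weighted second difference of bumps. -/
theorem exists_testFunction_second_difference {a b x₁ x₂ α β : ℝ} (hα : 0 ≤ α) (hβ : 0 ≤ β)
    (hαβ : α + β = 1) (φ : ContDiffBump (0 : ℝ)) (h₁ : x₁ ∈ Ioo (a + φ.rOut) (b - φ.rOut))
    (h₂ : x₂ ∈ Ioo (a + φ.rOut) (b - φ.rOut)) :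
    ∃ A, IsNonnegTestFunctionOn a b A ∧ ∀ s, iteratedDeriv 2 A s =
      α * φ.normed volume (s - x₁) + β * φ.normed volume (s - x₂) -
        φ.normed volume (s - (α * x₁ + β * x₂)) := by
  obtain ⟨E, κ, hE, hconv, hE2, hleft, hright⟩ := exists_smooth_ramp φ
  set x := α * x₁ + β * x₂ with hx
  set r := φ.rOut
  have hsub : ∀ u, ContDiff ℝ ((⊤ : ℕ∞) : WithTop ℕ∞) (fun s => E (s - u)) :=
    fun u => hE.comp (contDiff_id.sub contDiff_const)
  have hxm : x ∈ Icc (min x₁ x₂) (max x₁ x₂) :=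
    convex_Icc (𝕜 := ℝ) _ _ ⟨min_le_left _ _, le_max_left _ _⟩ ⟨min_le_right _ _, le_max_right _ _⟩
      hα hβ hαβ
  -- The second difference of the smoothed ramp vanishes wherever all three shifts lie on the same
  -- affine piece. Its nonnegativity below is the convexity of `E`.
  have hsupp : Function.support (fun s => α * E (s - x₁) + β * E (s - x₂) - E (s - x)) ⊆
      Icc (min x₁ x₂ - r) (max x₁ x₂ + r) := by
    intro s hs
    by_contra hns
    apply hs
    rw [mem_Icc, not_and_or, not_le, not_le] at hns
    have := min_le_left x₁ x₂
    have := min_le_right x₁ x₂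
    have := le_max_left x₁ x₂
    have := le_max_right x₁ x₂
    rcases hns with h | h
    · simp only
      rw [hleft _ (by linarith), hleft _ (by linarith), hleft _ (by linarith [hxm.1])]
      ring
    · simp only
      rw [hright _ (by linarith), hright _ (by linarith), hright _ (by linarith [hxm.2])]
      linear_combination (s + κ) * hαβ + hx
  have hts : tsupport (fun s => α * E (s - x₁) + β * E (s - x₂) - E (s - x)) ⊆
      Icc (min x₁ x₂ - r) (max x₁ x₂ + r) := closure_minimal hsupp isClosed_Icc
  refine ⟨fun s => α * E (s - x₁) + β * E (s - x₂) - E (s - x), ⟨?_, ?_, ?_, ?_⟩, ?_⟩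
  · exact ((contDiff_const.mul (hsub _)).add (contDiff_const.mul (hsub _))).sub (hsub _)
  · exact HasCompactSupport.of_support_subset_isCompact isCompact_Icc hsupp
  · refine hts.trans (Icc_subset_Ioo ?_ ?_)
    · rcases min_choice x₁ x₂ with h | h <;> rw [h] <;> linarith [h₁.1, h₂.1]
    · rcases max_choice x₁ x₂ with h | h <;> rw [h] <;> linarith [h₁.2, h₂.2]
  · intro s
    have := hconv.2 (mem_univ (s - x₁)) (mem_univ (s - x₂)) hα hβ hαβ
    simp only [smul_eq_mul] at this
    rw [show α * (s - x₁) + β * (s - x₂) = s - x by linear_combination s * hαβ + hx] at this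
    linarith
  · intro s
    have h2 : ∀ u, ContDiffAt ℝ (2 : ℕ) (fun s => E (s - u)) s :=
      fun u => (contDiff_infty.1 (hsub u) 2).contDiffAt
    rw [iteratedDeriv_fun_sub ((contDiffAt_const.mul (h2 _)).add (contDiffAt_const.mul (h2 _)))
        (h2 _),
      iteratedDeriv_fun_add (contDiffAt_const.mul (h2 _)) (contDiffAt_const.mul (h2 _)),
      iteratedDeriv_const_mul_field, iteratedDeriv_const_mul_field,
      iteratedDeriv_two_comp_sub_const, iteratedDeriv_two_comp_sub_const,
      iteratedDeriv_two_comp_sub_const, hE2]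

/-- Contracting towards the midpoint is affine and moves closed interval points inside; the
inequality survives the limit by continuity. -/
theorem convexOn_Icc_of_Ioo {a b : ℝ} {g : ℝ → ℝ} (hg : Continuous g)
    (h : ConvexOn ℝ (Ioo a b) g) : ConvexOn ℝ (Icc a b) g := by
  refine ⟨convex_Icc _ _, fun x hx y hy α β hα hβ hαβ => ?_⟩
  rcases (hx.1.trans hx.2).eq_or_lt with hab | hab
  · have hxy : x = y := by linarith [hx.1, hx.2, hy.1, hy.2]
    subst hxy
    rw [← add_smul, ← add_smul, hαβ, one_smul, one_smul]
  set m := (a + b) / 2 with hm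
  have hlim : ∀ z : ℝ, Tendsto (fun θ : ℝ => g (z + θ * (m - z))) (𝓝[>] 0) (𝓝 (g z)) := by
    intro z
    have : Continuous (fun θ : ℝ => g (z + θ * (m - z))) := by fun_prop
    have := this.tendsto 0
    simp only [zero_mul, add_zero] at this
    exact this.mono_left nhdsWithin_le_nhds
  refine le_of_tendsto_of_tendsto (hlim (α • x + β • y))
    (((hlim x).const_smul α).add ((hlim y).const_smul β)) ?_
  have hmem : ∀ z ∈ Icc a b, ∀ θ ∈ Ioo (0 : ℝ) 1, z + θ * (m - z) ∈ Ioo a b := by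
    rintro z ⟨hz1, hz2⟩ θ ⟨h0, h1⟩
    constructor <;> nlinarith
  filter_upwards [Ioo_mem_nhdsGT (zero_lt_one' ℝ)] with θ hθ
  have := h.2 (hmem x hx θ hθ) (hmem y hy θ hθ) hα hβ hαβ
  convert this using 2
  simp only [smul_eq_mul]
  linear_combination (-θ * m) * hαβ

/-- A continuous function with nonnegative distributional second derivative is convex. -/
theorem convexOn_of_forall_testFunction {a b : ℝ} {g : ℝ → ℝ} (hg : Continuous g)
    (h : ∀ A, IsNonnegTestFunctionOn a b A → 0 ≤ ∫ s, g s * iteratedDeriv 2 A s) :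
    ConvexOn ℝ (Icc a b) g := by
  refine convexOn_Icc_of_Ioo hg ⟨convex_Ioo _ _, fun x₁ h₁ x₂ h₂ α β hα hβ hαβ => ?_⟩
  simp only [smul_eq_mul]
  set ψ : ℕ → ContDiffBump (0 : ℝ) := fun n =>
    ⟨1 / (2 * ((n : ℝ) + 1)), 1 / ((n : ℝ) + 1), by positivity, by
      apply one_div_lt_one_div_of_lt <;> [positivity; linarith [(n.cast_nonneg : (0 : ℝ) ≤ n)]]⟩
  have hψ : Tendsto (fun n => (ψ n).rOut) atTop (𝓝 0) := tendsto_one_div_add_atTop_nhds_zero_nat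
  -- `I n u` is the mollification of `g` at `u`. Pairing `g` with the second derivative of the test
  -- function gives exactly a second difference of `I n`, and `n → ∞` yields the convexity
  -- inequality.
  set I : ℕ → ℝ → ℝ := fun n u => ∫ s, g s * (ψ n).normed volume (s - u) with hI
  have hlim : ∀ u, Tendsto (fun n => I n u) atTop (𝓝 (g u)) := by
    intro u
    have := ContDiffBump.convolution_tendsto_right_of_continuous (μ := volume) hψ hg u
    refine this.congr fun n => ?_
    rw [convolution_eq_swap]
    refine integral_congr_ae (ae_of_all _ fun s => ?_)
    simp only [ContinuousLinearMap.lsmul_apply, smul_eq_mul]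
    rw [← (ψ n).normed_neg, neg_sub, mul_comm]
  have hint : ∀ n u, Integrable (fun s => g s * (ψ n).normed volume (s - u)) := by
    intro n u
    refine Continuous.integrable_of_hasCompactSupport (hg.mul
      ((ψ n).continuous_normed.comp (continuous_id.sub continuous_const))) ?_
    refine HasCompactSupport.mul_left ?_
    exact (ψ n).hasCompactSupport_normed.comp_homeomorph (Homeomorph.subRight u)
  refine le_of_tendsto_of_tendsto (hlim _)
    (((hlim x₁).const_mul α).add ((hlim x₂).const_mul β)) ?_
  have hmem : ∀ u ∈ Ioo a b, ∀ᶠ n in atTop, u ∈ Ioo (a + (ψ n).rOut) (b - (ψ n).rOut) := by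
    intro u hu
    filter_upwards [hψ.eventually (gt_mem_nhds (sub_pos.2 hu.1)),
      hψ.eventually (gt_mem_nhds (sub_pos.2 hu.2))] with n h1 h2
    constructor <;> linarith
  filter_upwards [hmem x₁ h₁, hmem x₂ h₂] with n hn₁ hn₂
  obtain ⟨A, hA, hA2⟩ := exists_testFunction_second_difference hα hβ hαβ (ψ n) hn₁ hn₂
  have := h A hA
  have e : ∫ s, g s * iteratedDeriv 2 A s =
      α * I n x₁ + β * I n x₂ - I n (α * x₁ + β * x₂) := by
    simp only [hI]
    rw [← integral_const_mul, ← integral_const_mul, ← integral_add ((hint n _).const_mul _)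
      ((hint n _).const_mul _), ← integral_sub _ (hint n _)]
    · refine integral_congr_ae (ae_of_all _ fun s => ?_)
      simp only [hA2]
      ring
    · exact ((hint n _).const_mul _).add ((hint n _).const_mul _)
  rw [e] at this
  linarith

theorem IsNonnegTestFunctionOn.continuous_iteratedDeriv_two {a b : ℝ} {A : ℝ → ℝ}
    (hA : IsNonnegTestFunctionOn a b A) : Continuous (iteratedDeriv 2 A) :=
  (contDiff_infty.1 hA.1 2).continuous_iteratedDeriv 2 le_rfl

theorem IsNonnegTestFunctionOn.iteratedDeriv_two_eq_zero {a b : ℝ} {A : ℝ → ℝ}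
    (hA : IsNonnegTestFunctionOn a b A) {s : ℝ} (hs : s ∉ Ioo a b) : iteratedDeriv 2 A s = 0 := by
  have h : s ∉ tsupport A := fun h => hs (hA.2.2.1 h)
  have h1 : tsupport (deriv A) ⊆ tsupport A :=
    closure_minimal support_deriv_subset (isClosed_tsupport A)
  rw [iteratedDeriv_succ, iteratedDeriv_one]
  by_contra hne
  exact h (h1 (support_deriv_subset hne))

theorem isNonnegTestFunction_mul {a b c d : ℝ} {A B : ℝ → ℝ} (hA : IsNonnegTestFunctionOn a b A)
    (hB : IsNonnegTestFunctionOn c d B) :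
    IsNonnegTestFunction (interior (Icc a b ×ˢ Icc c d)) (fun p => A p.1 * B p.2) := by
  have hsupp : Function.support (fun p : ℝ × ℝ => A p.1 * B p.2) ⊆ tsupport A ×ˢ tsupport B := by
    intro p hp
    have := mul_ne_zero_iff.1 hp
    exact ⟨subset_tsupport _ this.1, subset_tsupport _ this.2⟩
  refine ⟨(hA.1.comp contDiff_fst).mul (hB.1.comp contDiff_snd),
    HasCompactSupport.of_support_subset_isCompact (hA.2.1.prod hB.2.1) hsupp, ?_,
    fun p => mul_nonneg (hA.2.2.2 _) (hB.2.2.2 _)⟩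
  rw [interior_prod_eq, interior_Icc, interior_Icc]
  exact (closure_minimal hsupp ((isClosed_tsupport A).prod (isClosed_tsupport B))).trans
    (prod_mono hA.2.2.1 hB.2.2.1)

/-- The fourth-order derivative of a product test function factors, so Fubini splits the pairing
into two one-dimensional ones. The domains of integration are interchangeable because the second
derivatives vanish off the open intervals. -/
theorem mixedDistribution_mul {a b c d : ℝ} {A B : ℝ → ℝ} (hA : IsNonnegTestFunctionOn a b A)
    (hB : IsNonnegTestFunctionOn c d B) {f : ℝ → ℝ → ℝ}
    (hf : Continuous (fun p : ℝ × ℝ => f p.1 p.2)) :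
    mixedDistribution (interior (Icc a b ×ˢ Icc c d)) f (fun p => A p.1 * B p.2) =
      -∫ s, (∫ t in Icc c d, f s t * iteratedDeriv 2 B t) * iteratedDeriv 2 A s := by
  have hA2 := hA.continuous_iteratedDeriv_two
  have hB2 := hB.continuous_iteratedDeriv_two
  have hd : ∀ p : ℝ × ℝ, iteratedDeriv 2 (fun t => iteratedDeriv 2 (fun s => A s * B t) p.1) p.2 =
      iteratedDeriv 2 A p.1 * iteratedDeriv 2 B p.2 := by
    intro p
    have : (fun t => iteratedDeriv 2 (fun s => A s * B t) p.1) =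
        fun t => iteratedDeriv 2 A p.1 * B t := by
      funext t
      simp only [mul_comm _ (B t)]
      rw [iteratedDeriv_const_mul_field]
    rw [this, iteratedDeriv_const_mul_field]
  have hcont : Continuous (fun p : ℝ × ℝ =>
      f p.1 p.2 * (iteratedDeriv 2 A p.1 * iteratedDeriv 2 B p.2)) := by fun_prop
  have hint : IntegrableOn (fun p : ℝ × ℝ =>
      f p.1 p.2 * (iteratedDeriv 2 A p.1 * iteratedDeriv 2 B p.2)) (Icc a b ×ˢ Icc c d) :=
    hcont.continuousOn.integrableOn_compact (isCompact_Icc.prod isCompact_Icc)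
  unfold mixedDistribution
  simp only [hd]
  congr 1
  have e : ∫ p in interior (Icc a b ×ˢ Icc c d),
      f p.1 p.2 * (iteratedDeriv 2 A p.1 * iteratedDeriv 2 B p.2) =
      ∫ p in Icc a b ×ˢ Icc c d,
        f p.1 p.2 * (iteratedDeriv 2 A p.1 * iteratedDeriv 2 B p.2) := by
    refine (setIntegral_eq_of_subset_of_forall_sdiff_eq_zero
      (measurableSet_Icc.prod measurableSet_Icc) interior_subset ?_).symm
    rintro p ⟨-, hp⟩
    rw [interior_prod_eq, interior_Icc, interior_Icc, mem_prod, not_and_or] at hp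
    rcases hp with hp | hp
    · rw [hA.iteratedDeriv_two_eq_zero hp]
      ring
    · rw [hB.iteratedDeriv_two_eq_zero hp]
      ring
  have e' : ∫ s, (∫ t in Icc c d, f s t * iteratedDeriv 2 B t) * iteratedDeriv 2 A s =
      ∫ s in Icc a b, (∫ t in Icc c d, f s t * iteratedDeriv 2 B t) * iteratedDeriv 2 A s := by
    refine (setIntegral_eq_integral_of_forall_compl_eq_zero fun s hs => ?_).symm
    rw [hA.iteratedDeriv_two_eq_zero fun h => hs (Ioo_subset_Icc_self h), mul_zero]
  rw [e, e', Measure.volume_eq_prod, setIntegral_prod _ hint]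
  · refine integral_congr_ae (ae_of_all _ fun s => ?_)
    simp only
    rw [← integral_mul_const]
    refine integral_congr_ae (ae_of_all _ fun t => ?_)
    simp only
    ring

/-- The pointwise form of the mixed Monge condition `∂xx (-∂yy f) ≥ 0`: the negative second
differences in `y` are convex in `x`. -/
def MongeDifference (X Y : Set ℝ) (f : ℝ → ℝ → ℝ) : Prop :=
  ∀ y₁ ∈ Y, ∀ y₂ ∈ Y, ∀ α β : ℝ, 0 ≤ α → 0 ≤ β → α + β = 1 →
    ConvexOn ℝ X (fun x => f x (α * y₁ + β * y₂) - α * f x y₁ - β * f x y₂)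

/-- The one-dimensional criterion is used twice. For fixed `B`, testing with all `A` makes `s ↦ -∫ f
s t B''(t) dt` convex. Read for fixed points in `x` and all `B`, this says that the negative second
difference in `x` has nonnegative second derivative in `y`, so it is convex in `y`. The resulting
inequality in four points only has to be rearranged. -/
theorem mongeDifference_of_continuous {a b c d : ℝ} {f : ℝ → ℝ → ℝ}
    (hf : Continuous (fun p : ℝ × ℝ => f p.1 p.2))
    (h : MongeNonneg (Icc a b) (Icc c d) f) : MongeDifference (Icc a b) (Icc c d) f := by
  have hslice : ∀ x, Continuous (f x) := fun x => hf.comp (continuous_const.prodMk continuous_id)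
  intro y₁ hy₁ y₂ hy₂ γ δ hγ hδ hγδ
  refine ⟨convex_Icc _ _, fun x₁ hx₁ x₂ hx₂ α β hα hβ hαβ => ?_⟩
  have hconv : ConvexOn ℝ (Icc c d)
      (fun t => f (α * x₁ + β * x₂) t - α * f x₁ t - β * f x₂ t) := by
    refine convexOn_of_forall_testFunction (((hslice _).sub ((hslice _).const_mul _)).sub
      ((hslice _).const_mul _)) fun B hB => ?_
    have hB2 := hB.continuous_iteratedDeriv_two
    have hgc : Continuous (fun s => -∫ t in Icc c d, f s t * iteratedDeriv 2 B t) := by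
      refine (continuous_parametric_integral_of_continuous ?_ isCompact_Icc).neg
      exact hf.mul (hB2.comp continuous_snd)
    have hg : ConvexOn ℝ (Icc a b) (fun s => -∫ t in Icc c d, f s t * iteratedDeriv 2 B t) := by
      refine convexOn_of_forall_testFunction hgc fun A hA => ?_
      have := h _ (isNonnegTestFunction_mul hA hB)
      rw [mixedDistribution_mul hA hB hf] at this
      simpa only [neg_mul, integral_neg] using this
    have hineq := hg.2 hx₁ hx₂ hα hβ hαβ
    simp only [smul_eq_mul] at hineq
    have hint : ∀ x, IntegrableOn (fun t => f x t * iteratedDeriv 2 B t) (Icc c d) :=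
      fun x => ((hslice x).mul hB2).continuousOn.integrableOn_compact isCompact_Icc
    have e : ∫ t, (f (α * x₁ + β * x₂) t - α * f x₁ t - β * f x₂ t) * iteratedDeriv 2 B t =
        (∫ t in Icc c d, f (α * x₁ + β * x₂) t * iteratedDeriv 2 B t) -
          α * (∫ t in Icc c d, f x₁ t * iteratedDeriv 2 B t) -
          β * ∫ t in Icc c d, f x₂ t * iteratedDeriv 2 B t := by
      rw [← setIntegral_eq_integral_of_forall_compl_eq_zero (s := Icc c d),
        ← integral_const_mul, ← integral_const_mul, ← integral_sub (hint _)
        ((hint _).const_mul _), ← integral_sub _ ((hint _).const_mul _)]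
      · refine integral_congr_ae (ae_of_all _ fun t => ?_)
        simp only
        ring
      · exact (hint _).sub ((hint _).const_mul _)
      · intro t ht
        rw [hB.iteratedDeriv_two_eq_zero fun h => ht (Ioo_subset_Icc_self h), mul_zero]
    rw [e]
    linarith
  have := hconv.2 hy₁ hy₂ hγ hδ hγδ
  simp only [smul_eq_mul] at this ⊢
  linarith

theorem MongeNonneg.congr {X Y : Set ℝ} {f g : ℝ → ℝ → ℝ} (h : MongeNonneg X Y f)
    (hfg : ∀ x ∈ X, ∀ y ∈ Y, f x y = g x y) : MongeNonneg X Y g := by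
  intro φ hφ
  have := h φ hφ
  unfold mixedDistribution at this ⊢
  rwa [setIntegral_congr_fun isOpen_interior.measurableSet] at this
  intro p hp
  have hp' := interior_subset hp
  simp only [hfg _ hp'.1 _ hp'.2]

theorem MongeNonneg.mongeDifference {a b c d : ℝ} (hab : a ≤ b) (hcd : c ≤ d) {f : ℝ → ℝ → ℝ}
    (hf : ContinuousOn (fun p : ℝ × ℝ => f p.1 p.2) (Icc a b ×ˢ Icc c d))
    (h : MongeNonneg (Icc a b) (Icc c d) f) : MongeDifference (Icc a b) (Icc c d) f := by
  -- Clamping both variables extends `f` to a continuous function on the plane; the Monge condition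
  -- sees only values in the rectangle.
  set F : ℝ → ℝ → ℝ := fun x y => f (projIcc a b hab x) (projIcc c d hcd y) with hF
  have hFf : ∀ x ∈ Icc a b, ∀ y ∈ Icc c d, f x y = F x y := by
    intro x hx y hy
    simp only [hF, projIcc_of_mem hab hx, projIcc_of_mem hcd hy]
  have hFc : Continuous (fun p : ℝ × ℝ => F p.1 p.2) := by
    refine hf.comp_continuous (f := fun p : ℝ × ℝ =>
      ((projIcc a b hab p.1 : ℝ), (projIcc c d hcd p.2 : ℝ))) ?_
      fun p => ⟨Subtype.coe_prop _, Subtype.coe_prop _⟩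
    exact (continuous_subtype_val.comp (continuous_projIcc.comp continuous_fst)).prodMk
      (continuous_subtype_val.comp (continuous_projIcc.comp continuous_snd))
  have := mongeDifference_of_continuous hFc (h.congr hFf)
  intro y₁ hy₁ y₂ hy₂ α β hα hβ hαβ
  refine (this y₁ hy₁ y₂ hy₂ α β hα hβ hαβ).congr fun x hx => ?_
  have hy := (convex_Icc c d) hy₁ hy₂ hα hβ hαβ
  simp only [smul_eq_mul] at hy
  simp only [hFf x hx _ hy, hFf x hx _ hy₁, hFf x hx _ hy₂]

theorem MongeNonpos.neg {X Y : Set ℝ} {f : ℝ → ℝ → ℝ} (h : MongeNonpos X Y f) :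
    MongeNonneg X Y (fun x y => -f x y) := by
  intro φ hφ
  have := h φ hφ
  unfold mixedDistribution at this ⊢
  simp only [neg_mul, integral_neg]
  linarith

/-- The mixed Monge condition of differences is symmetric in the two variables. -/
theorem MongeDifference.swap {X Y : Set ℝ} (hY : Convex ℝ Y) {f : ℝ → ℝ → ℝ}
    (h : MongeDifference X Y f) : MongeDifference Y X (fun y x => f x y) := by
  intro x₁ hx₁ x₂ hx₂ α β hα hβ hαβ
  refine ⟨hY, fun y₁ hy₁ y₂ hy₂ γ δ hγ hδ hγδ => ?_⟩
  have := (h y₁ hy₁ y₂ hy₂ γ δ hγ hδ hγδ).2 hx₁ hx₂ hα hβ hαβ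
  simp only [smul_eq_mul] at this ⊢
  linarith

end Distribution

/-! ## Convexity of the concrete networks -/

section Convexity

/-- Convexity of `φ` is required only on an interval containing the values of `z`, as splines are
convex only on their grid; monotonicity is global. -/
theorem convexOn_comp_of_mapsTo {E : Type*} [AddCommGroup E] [Module ℝ E] {S : Set E} {I : Set ℝ}
    {φ : ℝ → ℝ} {z : E → ℝ} (hφ : ConvexOn ℝ I φ) (hm : Monotone φ) (hz : ConvexOn ℝ S z)
    (hzI : ∀ x ∈ S, z x ∈ I) : ConvexOn ℝ S (fun x => φ (z x)) :=
  ⟨hz.1, fun x hx y hy _ _ hα hβ hαβ => (hm (hz.2 hx hy hα hβ hαβ)).trans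
    (hφ.2 (hzI x hx) (hzI y hy) hα hβ hαβ)⟩

theorem convexOn_mulVec {E : Type*} [AddCommGroup E] [Module ℝ E] {S : Set E} (hS : Convex ℝ S)
    {ι : Type*} {m : ℕ} {z : E → Fin m → ℝ} (hz : ∀ j, ConvexOn ℝ S (fun x => z x j))
    (W : Matrix ι (Fin m) ℝ) (i : ι) (hW : ∀ j, 0 ≤ W i j) :
    ConvexOn ℝ S (fun x => W.mulVec (z x) i) :=
  convexOn_finset_sum hS Finset.univ fun j _ => (hz j).smul (hW j)

theorem convexOn_mulVec_id {d : ℕ} {S : Set (Fin d → ℝ)} (hS : Convex ℝ S) {ι : Type*}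
    (U : Matrix ι (Fin d) ℝ) (i : ι) : ConvexOn ℝ S (fun x => U.mulVec x i) :=
  ((LinearMap.proj i : (ι → ℝ) →ₗ[ℝ] ℝ).comp U.mulVecLin).convexOn hS

theorem convexOn_iSup_fin {E : Type*} [AddCommGroup E] [Module ℝ E] {S : Set E} {k : ℕ}
    [Nonempty (Fin k)] {v : E → Fin k → ℝ} (hv : ∀ j, ConvexOn ℝ S (fun x => v x j)) :
    ConvexOn ℝ S (fun x => ⨆ j, v x j) := by
  have hle : ∀ x j, v x j ≤ ⨆ j, v x j := fun x j => le_ciSup (Set.finite_range _).bddAbove j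
  obtain ⟨j₀⟩ := ‹Nonempty (Fin k)›
  have : Nonempty (Fin k) := ⟨j₀⟩
  refine ⟨(hv j₀).1, fun x hx y hy α β hα hβ hαβ => ciSup_le fun j => ?_⟩
  refine ((hv j).2 hx hy hα hβ hαβ).trans (add_le_add ?_ ?_)
  · exact smul_le_smul_of_nonneg_left (hle x j) hα
  · exact smul_le_smul_of_nonneg_left (hle y j) hβ

theorem convexOn_diagonal {d : ℕ} {a b : ℝ} {f : (Fin d → ℝ) → ℝ}
    (hf : ConvexOn ℝ (Icc (fun _ => a) (fun _ => b)) f) :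
    ConvexOn ℝ (Icc a b) (fun t => f (fun _ => t)) :=
  ⟨convex_Icc _ _, fun _ hx _ hy _ _ hα hβ hαβ =>
    hf.2 ⟨fun _ => hx.1, fun _ => hx.2⟩ ⟨fun _ => hy.1, fun _ => hy.2⟩ hα hβ hαβ⟩

theorem IsICNNHidden.convexOn {A : Set (ℝ → ℝ)} (hA : ∀ σ ∈ A, ConvexOn ℝ univ σ ∧ Monotone σ)
    {d n : ℕ} {z : (Fin d → ℝ) → Fin n → ℝ} (h : IsICNNHidden A d n z) (i : Fin n) :
    ConvexOn ℝ univ (fun x => z x i) := by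
  induction h with
  | first n σ hσ U b =>
    exact convexOn_comp_of_mapsTo (hA σ hσ).1 (hA σ hσ).2
      ((convexOn_mulVec_id convex_univ U i).add_const (b i)) fun _ _ => mem_univ _
  | next m n z hz σ hσ W hW U b ih =>
    exact convexOn_comp_of_mapsTo (hA σ hσ).1 (hA σ hσ).2
      (((convexOn_mulVec convex_univ ih W i (hW i)).add
        (convexOn_mulVec_id convex_univ U i)).add_const (b i)) fun _ _ => mem_univ _

theorem convexityPreserving_icnnClass {A : Set (ℝ → ℝ)}
    (hA : ∀ σ ∈ A, ConvexOn ℝ univ σ ∧ Monotone σ) : ConvexityPreserving (icnnClass A) := by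
  rintro a b - g ⟨f, ⟨m, z, w, u, c, hz, hw, hf⟩, hg⟩
  have h : ConvexOn ℝ univ f := by
    refine ConvexOn.congr ?_ (fun x _ => (hf x).symm)
    exact ((convexOn_mulVec convex_univ (hz.convexOn hA) (fun _ : Unit => w) () hw).add
      (convexOn_mulVec_id convex_univ (fun _ : Unit => u) ())).add_const c
  rw [show g = fun t => f fun _ => t from funext hg]
  exact convexOn_diagonal (h.subset (subset_univ _) (convex_Icc _ _))

theorem IsGroupMaxLayer.convexOn {k : ℕ} (hk : 2 ≤ k) {skip : Bool} {d n : ℕ}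
    {z : (Fin d → ℝ) → Fin n → ℝ} (h : IsGroupMaxLayer k skip d n z) (i : Fin n) :
    ConvexOn ℝ univ (fun x => z x i) := by
  have : Nonempty (Fin k) := ⟨⟨0, by omega⟩⟩
  induction h with
  | first n U b =>
    exact convexOn_iSup_fin fun j =>
      (convexOn_mulVec_id convex_univ U (i, j)).add_const (b (i, j))
  | next m n z hz W hW U hU b ih =>
    exact convexOn_iSup_fin fun j =>
      ((convexOn_mulVec convex_univ ih W (i, j) (hW (i, j))).add
        (convexOn_mulVec_id convex_univ U (i, j))).add_const (b (i, j))

theorem convexityPreserving_groupMaxClass {k : ℕ} (hk : 2 ≤ k) (skip : Bool) :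
    ConvexityPreserving (groupMaxClass k skip) := by
  rintro a b - g ⟨z, hz, hg⟩
  rw [show g = fun t => z (fun _ => t) 0 from funext hg]
  exact convexOn_diagonal (f := fun x => z x 0)
    ((hz.convexOn hk 0).subset (subset_univ _) (convex_Icc _ _))

namespace P1Layer

variable {m n : ℕ} {lo hi : Fin m → ℝ} (L : P1Layer m n lo hi)

theorem convexOn_phi (i : Fin n) (j : Fin m) : ConvexOn ℝ (Icc (lo j) (hi j)) (L.phi i j) := by
  have := convexOn_p1Spline L.P_pos (L.knot_mono j) (L.offset i j) (L.slope_mono i j)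
  rwa [L.knot_first, L.knot_last] at this

/-- Linear pieces take their extremes at knots, so the range computed from the knots contains all
outputs, and the next layer's grid covers its inputs. -/
theorem eval_mem {x : Fin m → ℝ} (hx : x ∈ Icc lo hi) (i : Fin n) :
    L.eval x i ∈ Icc (L.outLo i) (L.outHi i) := by
  have h : ∀ j, L.phi i j (x j) ∈
      Icc (⨅ p, L.phi i j (L.knot j p)) (⨆ p, L.phi i j (L.knot j p)) := by
    intro j
    refine p1Spline_mem_Icc_knots L.P_pos (L.knot_mono j) (L.offset i j) (L.slope i j) ?_
    rw [L.knot_first, L.knot_last]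
    exact ⟨hx.1 j, hx.2 j⟩
  exact ⟨Finset.sum_le_sum fun j _ => (h j).1, Finset.sum_le_sum fun j _ => (h j).2⟩

end P1Layer

/-- The two conclusions go through the induction together: a further layer preserves convexity only
if its inputs stay in its grid. -/
theorem IsP1ICKAN.convexOn_and_mem {adaptive : Bool} {d n : ℕ} {lo hi : Fin d → ℝ}
    {lo' hi' : Fin n → ℝ} {z : (Fin d → ℝ) → Fin n → ℝ} (h : IsP1ICKAN adaptive lo hi n lo' hi' z) :
    (∀ i, ConvexOn ℝ (Icc lo hi) (fun x => z x i)) ∧ ∀ x ∈ Icc lo hi, z x ∈ Icc lo' hi' := by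
  induction h with
  | first n L hL =>
    refine ⟨fun i => convexOn_finset_sum (convex_Icc _ _) _ fun j _ => ?_,
      fun x hx => ⟨fun i => (L.eval_mem hx i).1, fun i => (L.eval_mem hx i).2⟩⟩
    exact ((L.convexOn_phi i j).comp_linearMap (LinearMap.proj j : (Fin d → ℝ) →ₗ[ℝ] ℝ)).subset
      (fun x hx => ⟨hx.1 j, hx.2 j⟩) (convex_Icc _ _)
  | next m n lo' hi' z hz L hL hmono ih =>
    refine ⟨fun i => convexOn_finset_sum (convex_Icc _ _) _ fun j _ => ?_, fun x hx =>
      ⟨fun i => (L.eval_mem (ih.2 x hx) i).1, fun i => (L.eval_mem (ih.2 x hx) i).2⟩⟩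
    exact convexOn_comp_of_mapsTo (L.convexOn_phi i j) (monotone_p1Spline _ (hmono i j)) (ih.1 j)
      fun x hx => ⟨(ih.2 x hx).1 j, (ih.2 x hx).2 j⟩

theorem convexityPreserving_p1ICKANClass (adaptive : Bool) :
    ConvexityPreserving (p1ICKANClass adaptive) := by
  rintro a b - g ⟨lo', hi', z, hz, hg⟩
  rw [show g = fun t => z (fun _ => t) 0 from funext hg]
  exact convexOn_diagonal (f := fun x => z x 0) (hz.convexOn_and_mem.1 0)

end Convexity

/-! ## Universal approximation by the concrete networks -/

section Approximation

theorem exists_interpolation_lt {a b : ℝ} (hab : a ≤ b) {g : ℝ → ℝ}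
    (hg : ContinuousOn g (Icc a b)) {ε : ℝ} (hε : 0 < ε) :
    ∃ n, ∀ t ∈ Icc a b,
      |g t - p1Spline (uniformKnot a b n) (g a) (chordSlope (uniformKnot a b n) g) t| < ε := by
  have huc := isCompact_Icc.uniformContinuousOn_of_continuous hg
  obtain ⟨δ, hδ, h⟩ := Metric.uniformContinuousOn_iff.1 huc (ε / 2) (half_pos hε)
  obtain ⟨n, hn⟩ := exists_uniformKnot_mesh_lt a b hδ
  refine ⟨n, fun t ht => ?_⟩
  have := abs_p1Spline_chordSlope_sub_le n.succ_pos (uniformKnot_mono hab n) g (ε := ε / 2)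
    (t := t) (by rwa [uniformKnot_zero, uniformKnot_last]) fun p hp u hu => ?_
  · rw [uniformKnot_zero] at this
    rw [abs_sub_comm]
    linarith
  · have hmesh := uniformKnot_succ_sub a b n p
    refine (h u ⟨(uniformKnot_mem hab n _).1.trans hu.1, hu.2.trans (uniformKnot_mem hab n _).2⟩
      t ht ?_).le
    rw [Real.dist_eq, abs_lt]
    constructor <;> linarith [hu.1, hu.2, hp.1, hp.2]

/-- A class that contains all affine functions plus nonnegative combinations of ramps is a
universal convex approximator. -/
theorem universalConvexApproximator_of_ramps {C : NetworkClass}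
    (h : ∀ (a b : ℝ) (n : ℕ) (k w : Fin n → ℝ) (s c : ℝ), (∀ p, 0 ≤ w p) →
      (fun t => c + s * (t - a) + ∑ p, w p * max (t - k p) 0) ∈ C a b) :
    UniversalConvexApproximator C := by
  intro a b hab g hgc hg ε hε
  obtain ⟨n, hn⟩ := exists_interpolation_lt hab hgc hε
  have hmono := chordSlope_uniformKnot_mono hab hg n
  refine ⟨_, h a b n (fun p => uniformKnot a b n p.succ.castSucc)
    (fun p => chordSlope (uniformKnot a b n) g p.succ -
      chordSlope (uniformKnot a b n) g p.castSucc)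
    (chordSlope (uniformKnot a b n) g 0) (g a)
    (fun p => sub_nonneg.2 (hmono (Fin.castSucc_le_succ p))), fun t ht => ?_⟩
  have := hn t ht
  rwa [p1Spline_eq_sum_ramps (uniformKnot_mono hab n) _ _
    (by rwa [uniformKnot_zero, uniformKnot_last]), uniformKnot_zero] at this

theorem universalConvexApproximator_icnnClass {A : Set (ℝ → ℝ)} (hA : relu ∈ A) :
    UniversalConvexApproximator (icnnClass A) := by
  refine universalConvexApproximator_of_ramps fun a b n k w s c hw => ?_
  -- One hidden layer holds the ramps; the skip connection to the output carries the affine part.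
  refine ⟨_, ⟨n, _, w, fun _ => s, c - s * a,
    .first n relu hA (fun _ _ => 1) (fun p => -k p), hw, fun x => rfl⟩, fun t => ?_⟩
  simp only [dotProduct, relu, Matrix.mulVec, Pi.add_apply, Finset.univ_unique,
    Finset.sum_singleton, one_mul, ← sub_eq_add_neg]
  ring

theorem universalConvexApproximator_groupMaxClass {k : ℕ} (hk : 2 ≤ k) (skip : Bool) :
    UniversalConvexApproximator (groupMaxClass k skip) := by
  have hne : Nonempty (Fin k) := ⟨⟨0, by omega⟩⟩
  refine universalConvexApproximator_of_ramps fun a b n q w s c hw => ?_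
  -- Group `0` consists of copies of the affine part. Every other group has one unit `t - q p` and
  -- otherwise zeros, so its maximum is a ramp, since `k ≥ 2`. The second layer sums these in
  -- identical units; carrying the affine part as a hidden unit makes skip connections unnecessary.
  let U : Matrix (Fin (n + 1) × Fin k) (Fin 1) ℝ := fun r _ =>
    Fin.cases s (fun _ => if (r.2 : ℕ) = 0 then 1 else 0) r.1
  let v : Fin (n + 1) × Fin k → ℝ := fun r =>
    Fin.cases (c - s * a) (fun p => if (r.2 : ℕ) = 0 then -q p else 0) r.1
  let W : Matrix (Fin 1 × Fin k) (Fin (n + 1)) ℝ := fun _ j => Fin.cases 1 w j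
  have hW : ∀ i j, 0 ≤ W i j := by
    intro i j
    refine Fin.cases ?_ (fun p => ?_) j
    · exact zero_le_one
    · exact hw p
  refine ⟨_, .next (n + 1) 1 _ (.first (n + 1) U v) W hW 0 (.inr rfl) 0, fun t => ?_⟩
  have h0 : groupMax (U.mulVec (fun _ => t) + v) 0 = c + s * (t - a) := by
    simp only [groupMax, Matrix.mulVec, dotProduct, Pi.add_apply, Finset.univ_unique,
      Finset.sum_singleton, U, v, Fin.cases_zero, ciSup_const]
    ring
  have h1 : ∀ p : Fin n, groupMax (U.mulVec (fun _ => t) + v) p.succ = max (t - q p) 0 := by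
    intro p
    simp only [groupMax, Matrix.mulVec, dotProduct, Pi.add_apply, Finset.univ_unique,
      Finset.sum_singleton, U, v, Fin.cases_succ]
    refine le_antisymm (ciSup_le fun j => ?_) (max_le ?_ ?_)
    · split_ifs
      · rw [one_mul, ← sub_eq_add_neg]
        exact le_max_left _ _
      · simp
    · refine le_ciSup_of_le (Set.finite_range _).bddAbove ⟨0, by omega⟩ ?_
      simp [sub_eq_add_neg]
    · refine le_ciSup_of_le (Set.finite_range _).bddAbove ⟨1, by omega⟩ ?_
      simp
  have h2 : ∀ x : Fin (n + 1) → ℝ, groupMax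
      (W.mulVec x + (0 : Matrix (Fin 1 × Fin k) (Fin 1) ℝ).mulVec (fun _ => t) + 0) 0 = x 0 + ∑ p : Fin n, w p * x p.succ := by
    intro x
    simp only [groupMax, Matrix.zero_mulVec, add_zero, Matrix.mulVec, dotProduct, W,
      Fin.sum_univ_succ, Fin.cases_zero, Fin.cases_succ, one_mul, ciSup_const]
  simp only [h2, h0, h1]

theorem universalConvexApproximator_p1ICKANClass (adaptive : Bool) :
    UniversalConvexApproximator (p1ICKANClass adaptive) := by
  intro a b hab g hgc hg ε hε
  obtain ⟨n, hn⟩ := exists_interpolation_lt hab hgc hε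
  -- A single layer realizes the interpolant, and its uniform grid is admissible in both grid modes.
  let L : P1Layer 1 1 (fun _ => a) (fun _ => b) :=
    { P := n + 1
      P_pos := n.succ_pos
      knot := fun _ => uniformKnot a b n
      knot_mono := fun _ => uniformKnot_mono hab n
      knot_first := fun _ => uniformKnot_zero a b n
      knot_last := fun _ => uniformKnot_last a b n
      offset := fun _ _ => g a
      slope := fun _ _ => chordSlope (uniformKnot a b n) g
      slope_mono := fun _ _ => chordSlope_uniformKnot_mono hab hg n }
  refine ⟨_, ⟨_, _, _, .first 1 L (.inr fun _ _ => rfl), fun t => rfl⟩, fun t ht => ?_⟩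
  simpa [P1Layer.eval, P1Layer.phi, L] using hn t ht

end Approximation

theorem IsConcreteFamily.convexityPreserving {C : NetworkClass} (hC : IsConcreteFamily C) :
    ConvexityPreserving C := by
  rcases hC with ⟨A, -, hA, rfl⟩ | ⟨k, skip, hk, rfl⟩ | ⟨adaptive, rfl⟩
  · exact convexityPreserving_icnnClass hA
  · exact convexityPreserving_groupMaxClass hk skip
  · exact convexityPreserving_p1ICKANClass adaptive

theorem IsConcreteFamily.universalConvexApproximator {C : NetworkClass}
    (hC : IsConcreteFamily C) : UniversalConvexApproximator C := by
  rcases hC with ⟨A, hrelu, -, rfl⟩ | ⟨k, skip, hk, rfl⟩ | ⟨adaptive, rfl⟩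
  · exact universalConvexApproximator_icnnClass hrelu
  · exact universalConvexApproximator_groupMaxClass hk skip
  · exact universalConvexApproximator_p1ICKANClass adaptive

/-! ## Decomposition of convex-concave functions -/

section Decomposition

/-- The Green kernel of `-∂yy` on `[c, d]` with Dirichlet boundary conditions. -/
noncomputable def greenKernel (c d t y : ℝ) : ℝ := (y - c) * (d - t) / (d - c) - max (y - t) 0

theorem continuous_greenKernel (c d t : ℝ) : Continuous (greenKernel c d t) := by
  unfold greenKernel
  fun_prop

theorem concaveOn_of_affine {S : Set ℝ} (hS : Convex ℝ S) {g : ℝ → ℝ} (m q : ℝ)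
    (hg : ∀ y, g y = m * y + q) : ConcaveOn ℝ S g := by
  refine ⟨hS, fun x _ y _ α β _ _ h => le_of_eq ?_⟩
  simp only [smul_eq_mul, hg]
  linear_combination q * h

theorem concaveOn_greenKernel (c d t : ℝ) : ConcaveOn ℝ (Icc c d) (greenKernel c d t) :=
  (concaveOn_of_affine (convex_Icc c d) ((d - t) / (d - c)) (-c * (d - t) / (d - c))
    fun y => by ring).sub (convexOn_ramp _ (convex_Icc c d) t)

theorem greenKernel_nonneg {c d t y : ℝ} (hcd : c < d) (ht : t ∈ Icc c d) (hy : y ∈ Icc c d) :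
    0 ≤ greenKernel c d t y := by
  have hpos := sub_pos.2 hcd
  rw [greenKernel, sub_nonneg, le_div_iff₀ hpos]
  obtain ⟨ht1, ht2⟩ := ht
  obtain ⟨hy1, hy2⟩ := hy
  rcases le_total (y - t) 0 with h | h
  · rw [max_eq_right h]
    nlinarith
  · rw [max_eq_left h]
    nlinarith

/-- The interpolating spline is the chord plus a combination of Green kernels. -/
theorem p1Spline_chordSlope_eq_green {n : ℕ} {k : Fin (n + 2) → ℝ} (hk : Monotone k) {c d : ℝ}
    (hc : k 0 = c) (hd : k (Fin.last (n + 1)) = d) (hcd : c < d) (g : ℝ → ℝ) {y : ℝ}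
    (hy : y ∈ Icc c d) :
    p1Spline k (g c) (chordSlope k g) y =
      g c * ((d - y) / (d - c)) + g d * ((y - c) / (d - c)) +
        ∑ p : Fin n, (chordSlope k g p.castSucc - chordSlope k g p.succ) *
          greenKernel c d (k p.succ.castSucc) y := by
  have hne : d - c ≠ 0 := (sub_pos.2 hcd).ne'
  have hy' := p1Spline_eq_sum_ramps hk (g c) (chordSlope k g) (t := y) (by rwa [hc, hd])
  -- Evaluation at the right end determines the initial slope from the chord and the jumps;
  -- eliminating it turns ramps into Green kernels.
  have hd' := p1Spline_eq_sum_ramps hk (g c) (chordSlope k g) (t := d)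
    (by rw [hc, hd]; exact ⟨hcd.le, le_rfl⟩)
  have hval := p1Spline_chordSlope_knot hk g (Fin.last (n + 1))
  rw [hc, hd] at hval
  rw [hval, hc] at hd'
  rw [hc] at hy'
  have hmax : ∀ p : Fin n, max (d - k p.succ.castSucc) 0 = d - k p.succ.castSucc := by
    intro p
    refine max_eq_left ?_
    rw [← hd]
    exact sub_nonneg.2 (hk (Fin.le_last _))
  simp only [hmax] at hd'
  have hsum : ∑ p : Fin n, (chordSlope k g p.castSucc - chordSlope k g p.succ) *
      greenKernel c d (k p.succ.castSucc) y =
      -((y - c) / (d - c)) * ∑ p : Fin n, (chordSlope k g p.succ - chordSlope k g p.castSucc) *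
          (d - k p.succ.castSucc) +
        ∑ p : Fin n, (chordSlope k g p.succ - chordSlope k g p.castSucc) *
          max (y - k p.succ.castSucc) 0 := by
    rw [Finset.mul_sum, ← Finset.sum_add_distrib]
    refine Finset.sum_congr rfl fun p _ => ?_
    unfold greenKernel
    ring
  rw [hy', hsum]
  field_simp
  linear_combination (-(y - c)) * hd'

/-- Uniform spacing makes the middle knot the midpoint of its neighbours, so the slope drop is a
second difference of the form covered by `MongeDifference`. -/
theorem chordSlope_sub_uniformKnot (c d : ℝ) (n : ℕ) (g : ℝ → ℝ) (p : Fin n) :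
    let k := uniformKnot c d n
    chordSlope k g p.castSucc - chordSlope k g p.succ =
      2 / ((d - c) / (n + 1)) * (g (1 / 2 * k p.castSucc.castSucc + 1 / 2 * k p.succ.succ) -
        1 / 2 * g (k p.castSucc.castSucc) - 1 / 2 * g (k p.succ.succ)) := by
  intro k
  have h1 := uniformKnot_succ_sub c d n p.castSucc
  have h2 := uniformKnot_succ_sub c d n p.succ
  have hm : 1 / 2 * k p.castSucc.castSucc + 1 / 2 * k p.succ.succ = k p.castSucc.succ := by
    rw [← Fin.succ_castSucc] at h2
    linear_combination 1 / 2 * h2 - 1 / 2 * h1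
  simp only [chordSlope, k] at hm ⊢
  rw [hm, h1, h2, Fin.succ_castSucc]
  ring

theorem continuousOn_slice {X Y : Set ℝ} {f : ℝ → ℝ → ℝ}
    (hf : ContinuousOn (fun p : ℝ × ℝ => f p.1 p.2) (X ×ˢ Y)) {y : ℝ} (hy : y ∈ Y) :
    ContinuousOn (fun x => f x y) X :=
  hf.comp (f := fun x => (x, y)) (by fun_prop) fun _ hx => ⟨hx, hy⟩

/-- A convex-concave function with `∂xx (-∂yy f) ≥ 0` is a uniform limit of sums of products of a
nonnegative convex function of `x` and a nonnegative concave function of `y`, up to constants. -/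
theorem exists_convex_mul_concave_near {a b c d : ℝ} (hcd : c ≤ d) {f : ℝ → ℝ → ℝ}
    (hf : IsConvexConcave (Icc a b) (Icc c d) f) (hM : MongeDifference (Icc a b) (Icc c d) f)
    {ε : ℝ} (hε : 0 < ε) :
    ∃ N ≥ 1, ∃ (e κ : Fin N → ℝ → ℝ) (M : ℝ),
      (∀ i, ContinuousOn (e i) (Icc a b) ∧ ConvexOn ℝ (Icc a b) (e i) ∧ ∀ x ∈ Icc a b, 0 ≤ e i x) ∧
      (∀ i, ContinuousOn (κ i) (Icc c d) ∧ ConcaveOn ℝ (Icc c d) (κ i) ∧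
        ∀ y ∈ Icc c d, 0 ≤ κ i y) ∧
      ∀ x ∈ Icc a b, ∀ y ∈ Icc c d, |f x y - (∑ i, e i x * κ i y - M)| < ε := by
  obtain ⟨hcont, hconv, hconc⟩ := hf
  obtain ⟨M, hMb⟩ := (isCompact_Icc.prod isCompact_Icc).exists_bound_of_continuousOn hcont
  have hMf : ∀ x ∈ Icc a b, ∀ y ∈ Icc c d, 0 ≤ f x y + M := by
    intro x hx y hy
    have := (abs_le.1 (hMb (x, y) ⟨hx, hy⟩)).1
    simp only at this
    linarith
  have hedge : ∀ y ∈ Icc c d, ContinuousOn (fun x => f x y + M) (Icc a b) ∧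
      ConvexOn ℝ (Icc a b) (fun x => f x y + M) ∧ ∀ x ∈ Icc a b, 0 ≤ f x y + M := fun y hy =>
    ⟨(continuousOn_slice hcont hy).add continuousOn_const, (hconv y hy).add_const M,
      fun x hx => hMf x hx y hy⟩
  rcases hcd.eq_or_lt with rfl | hlt
  -- A degenerate `[c, d]` has no Green kernel; the single product `(f x c + M) · 1` is exact.
  · refine ⟨1, le_rfl, fun _ x => f x c + M, fun _ _ => 1, M, fun _ => hedge c ⟨le_rfl, le_rfl⟩,
      fun _ => ⟨continuousOn_const, concaveOn_const _ (convex_Icc _ _), fun _ _ => zero_le_one⟩,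
      fun x hx y hy => ?_⟩
    rw [Icc_self, mem_singleton_iff] at hy
    simpa [hy] using hε
  have huc := (isCompact_Icc.prod isCompact_Icc).uniformContinuousOn_of_continuous hcont
  obtain ⟨δ, hδ, h⟩ := Metric.uniformContinuousOn_iff.1 huc (ε / 2) (half_pos hε)
  obtain ⟨n, hn⟩ := exists_uniformKnot_mesh_lt c d hδ
  have hmono := uniformKnot_mono hcd n
  have hmem := uniformKnot_mem hcd n
  have hpos : 0 < d - c := sub_pos.2 hlt
  have hscale : 0 ≤ 2 / ((d - c) / ((n : ℝ) + 1)) := by positivity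
  set k := uniformKnot c d n with hk
  -- The coefficients of the Green kernels: convex in `x` by the Monge condition, nonnegative by
  -- concavity in `y`.
  let J : Fin n → ℝ → ℝ := fun p x =>
    chordSlope k (f x) p.castSucc - chordSlope k (f x) p.succ
  have hJ : ∀ p x, J p x = 2 / ((d - c) / (n + 1)) *
      (f x (1 / 2 * k p.castSucc.castSucc + 1 / 2 * k p.succ.succ) -
        1 / 2 * f x (k p.castSucc.castSucc) - 1 / 2 * f x (k p.succ.succ)) :=
    fun p x => chordSlope_sub_uniformKnot c d n (f x) p
  have hmid : ∀ p : Fin n, 1 / 2 * k p.castSucc.castSucc + 1 / 2 * k p.succ.succ ∈ Icc c d :=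
    fun p => convex_Icc (𝕜 := ℝ) c d (hmem _) (hmem _) (by norm_num) (by norm_num) (by norm_num)
  refine ⟨n + 2, by omega,
    Fin.cons (fun x => f x c + M) (Fin.cons (fun x => f x d + M) J),
    Fin.cons (fun y => (d - y) / (d - c)) (Fin.cons (fun y => (y - c) / (d - c))
      fun p => greenKernel c d (k p.succ.castSucc)), M, ?_, ?_, fun x hx y hy => ?_⟩
  · simp only [Fin.forall_fin_succ (n := n + 1), Fin.forall_fin_succ (n := n), Fin.cons_zero,
      Fin.cons_succ]
    refine ⟨hedge c ⟨le_rfl, hcd⟩, hedge d ⟨hcd, le_rfl⟩, fun p => ⟨?_, ?_, ?_⟩⟩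
    · rw [funext (hJ p)]
      exact continuousOn_const.mul (((continuousOn_slice hcont (hmid p)).sub
        (continuousOn_const.mul (continuousOn_slice hcont (hmem _)))).sub
        (continuousOn_const.mul (continuousOn_slice hcont (hmem _))))
    · rw [funext (hJ p)]
      exact (hM _ (hmem _) _ (hmem _) (1 / 2) (1 / 2) (by norm_num) (by norm_num)
        (by norm_num)).smul hscale
    · intro x hx
      rw [hJ]
      have := (hconc x hx).2 (hmem p.castSucc.castSucc) (hmem p.succ.succ)
        (by norm_num : (0 : ℝ) ≤ 1 / 2) (by norm_num : (0 : ℝ) ≤ 1 / 2) (by norm_num)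
      simp only [smul_eq_mul] at this
      exact mul_nonneg hscale (by linarith)
  · simp only [Fin.forall_fin_succ (n := n + 1), Fin.forall_fin_succ (n := n), Fin.cons_zero,
      Fin.cons_succ]
    refine ⟨⟨by fun_prop, ?_, ?_⟩, ⟨by fun_prop, ?_, ?_⟩, fun p =>
      ⟨(continuous_greenKernel _ _ _).continuousOn, concaveOn_greenKernel _ _ _,
        fun y hy => greenKernel_nonneg hlt (hmem _) hy⟩⟩
    · exact concaveOn_of_affine (convex_Icc c d) (-1 / (d - c)) (d / (d - c)) fun y => by ring
    · exact fun y hy => div_nonneg (by linarith [hy.2]) hpos.le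
    · exact concaveOn_of_affine (convex_Icc c d) (1 / (d - c)) (-c / (d - c)) fun y => by ring
    · exact fun y hy => div_nonneg (by linarith [hy.1]) hpos.le
  · have hc : k 0 = c := uniformKnot_zero c d n
    have hd : k (Fin.last (n + 1)) = d := uniformKnot_last c d n
    have hgreen := p1Spline_chordSlope_eq_green hmono hc hd hlt (f x) hy
    have happrox := abs_p1Spline_chordSlope_sub_le n.succ_pos hmono (f x) (ε := ε / 2) (t := y)
      (by rwa [hc, hd]) fun p hp u hu => ?_
    · rw [hc, hgreen] at happrox
      have e : ∑ i : Fin (n + 2), (Fin.cons (fun x => f x c + M) (Fin.cons (fun x => f x d + M) J) :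
            Fin (n + 2) → ℝ → ℝ) i x *
          (Fin.cons (fun y => (d - y) / (d - c)) (Fin.cons (fun y => (y - c) / (d - c))
            fun p => greenKernel c d (k p.succ.castSucc)) : Fin (n + 2) → ℝ → ℝ) i y - M =
          f x c * ((d - y) / (d - c)) + f x d * ((y - c) / (d - c)) +
            ∑ p : Fin n, J p x * greenKernel c d (k p.succ.castSucc) y := by
        simp only [Fin.sum_univ_succ (n := n + 1), Fin.sum_univ_succ (n := n), Fin.cons_zero,
          Fin.cons_succ]
        field_simp
        ring
      rw [e, abs_sub_comm]
      linarith
    · have hmesh : k p.succ - k p.castSucc = (d - c) / (n + 1) := uniformKnot_succ_sub c d n p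
      have hu' : u ∈ Icc c d := ⟨(hmem _).1.trans hu.1, hu.2.trans (hmem _).2⟩
      refine (h (x, u) ⟨hx, hu'⟩ (x, y) ⟨hx, hy⟩ ?_).le
      rw [Prod.dist_eq, dist_self, max_eq_right dist_nonneg, Real.dist_eq, abs_lt]
      constructor <;> linarith [hu.1, hu.2, hp.1, hp.2]

end Decomposition

/-! ## Approximation of the components by networks -/

section Density

theorem exists_mul_near {X Y : Set ℝ} (hX : IsCompact X) (hY : IsCompact Y) {e κ : ℝ → ℝ}
    (he : ContinuousOn e X) (hκ : ContinuousOn κ Y) {ε : ℝ} (hε : 0 < ε) :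
    ∃ δ > 0, ∀ e' κ' : ℝ → ℝ, (∀ x ∈ X, |e x - e' x| < δ) → (∀ y ∈ Y, |κ y - κ' y| < δ) →
      ∀ x ∈ X, ∀ y ∈ Y, |e x * κ y - e' x * κ' y| < ε := by
  obtain ⟨M₁, h₁⟩ := hX.exists_bound_of_continuousOn he
  obtain ⟨M₂, h₂⟩ := hY.exists_bound_of_continuousOn hκ
  -- The extra `1` bounds `e'` as well, because `δ ≤ 1`, and makes the bound on `κ` strict.
  set M := |M₁| + |M₂| + 1 with hM
  have hMpos : 0 < M := by positivity
  refine ⟨min 1 (ε / (2 * M)), by positivity, fun e' κ' he' hκ' x hx y hy => ?_⟩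
  set δ := min 1 (ε / (2 * M)) with hδ
  have hδ1 : δ ≤ 1 := min_le_left _ _
  have hδ2 : 2 * M * δ ≤ ε := by
    have : δ ≤ ε / (2 * M) := min_le_right _ _
    rw [le_div_iff₀ (by positivity)] at this
    linarith
  have hex := h₁ x hx
  have hκy := h₂ y hy
  rw [Real.norm_eq_abs] at hex hκy
  have b₁ : |e x| + 1 ≤ M := by linarith [le_abs_self M₁, abs_nonneg M₂]
  have b₂ : |κ y| < M := by linarith [le_abs_self M₂, abs_nonneg M₁]
  have d₁ := he' x hx
  have d₂ := hκ' y hy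
  have b₃ : |e' x| ≤ M := by
    have := abs_sub_abs_le_abs_sub (e' x) (e x)
    rw [abs_sub_comm] at this
    linarith
  have hδ0 : 0 < δ := (abs_nonneg _).trans_lt d₁
  calc |e x * κ y - e' x * κ' y| = |(e x - e' x) * κ y + e' x * (κ y - κ' y)| := by ring_nf
    _ ≤ |e x - e' x| * |κ y| + |e' x| * |κ y - κ' y| := by
      rw [← abs_mul, ← abs_mul]
      exact abs_add_le _ _
    _ < δ * M + M * δ := by
      refine add_lt_add_of_lt_of_le ?_ ?_
      · exact mul_lt_mul'' d₁ b₂ (abs_nonneg _) (abs_nonneg _)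
      · exact mul_le_mul b₃ d₂.le (abs_nonneg _) hMpos.le
    _ ≤ ε := by linarith

variable {C : NetworkClass} {a b : ℝ} {g : ℝ → ℝ} {δ : ℝ}

/-- Approximating `g + δ / 2` within `δ / 2` gives a network above `g`, hence nonnegative, and still
within `δ`. The nonpositive case shifts downwards. -/
theorem UniversalConvexApproximator.exists_nonneg_near (hU : UniversalConvexApproximator C)
    (hab : a ≤ b) (hgc : ContinuousOn g (Icc a b)) (hg : ConvexOn ℝ (Icc a b) g)
    (h0 : ∀ x ∈ Icc a b, 0 ≤ g x) (hδ : 0 < δ) :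
    ∃ n ∈ C a b, (∀ x ∈ Icc a b, 0 ≤ n x) ∧ ∀ x ∈ Icc a b, |g x - n x| < δ := by
  obtain ⟨n, hn, h⟩ := hU a b hab (fun x => g x + δ / 2) (hgc.add continuousOn_const)
    (hg.add_const _) (δ / 2) (half_pos hδ)
  refine ⟨n, hn, fun x hx => ?_, fun x hx => ?_⟩ <;> have := abs_lt.1 (h x hx)
  · linarith [h0 x hx, this.2]
  · rw [abs_lt]
    constructor <;> linarith [this.1, this.2]

theorem UniversalConvexApproximator.exists_nonpos_near (hU : UniversalConvexApproximator C)
    (hab : a ≤ b) (hgc : ContinuousOn g (Icc a b)) (hg : ConvexOn ℝ (Icc a b) g)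
    (h0 : ∀ x ∈ Icc a b, g x ≤ 0) (hδ : 0 < δ) :
    ∃ n ∈ C a b, (∀ x ∈ Icc a b, n x ≤ 0) ∧ ∀ x ∈ Icc a b, |g x - n x| < δ := by
  obtain ⟨n, hn, h⟩ := hU a b hab (fun x => g x + (-(δ / 2))) (hgc.add continuousOn_const)
    (hg.add_const _) (δ / 2) (half_pos hδ)
  refine ⟨n, hn, fun x hx => ?_, fun x hx => ?_⟩ <;> have := abs_lt.1 (h x hx)
  · linarith [h0 x hx, this.1]
  · rw [abs_lt]
    constructor <;> linarith [this.1, this.2]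

/-- Saddle networks are dense in the saddle sums with continuous components. -/
theorem exists_saddleNetwork_near (hC : ConvexityPreserving C)
    (hU : UniversalConvexApproximator C) {c d : ℝ} (hab : a ≤ b) (hcd : c ≤ d) {N : ℕ}
    {e₁ e₂ κ α : Fin N → ℝ → ℝ} {H G : ℝ → ℝ}
    (he₁ : ∀ i, ContinuousOn (e₁ i) (Icc a b) ∧ ConvexOn ℝ (Icc a b) (e₁ i) ∧
      ∀ x ∈ Icc a b, 0 ≤ e₁ i x)
    (he₂ : ∀ i, ContinuousOn (e₂ i) (Icc a b) ∧ ConvexOn ℝ (Icc a b) (e₂ i) ∧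
      ∀ x ∈ Icc a b, e₂ i x ≤ 0)
    (hκ : ∀ i, ContinuousOn (κ i) (Icc c d) ∧ ConcaveOn ℝ (Icc c d) (κ i) ∧
      ∀ y ∈ Icc c d, 0 ≤ κ i y)
    (hα : ∀ i, ContinuousOn (α i) (Icc c d) ∧ ConvexOn ℝ (Icc c d) (α i) ∧
      ∀ y ∈ Icc c d, 0 ≤ α i y)
    (hH : ContinuousOn H (Icc a b) ∧ ConvexOn ℝ (Icc a b) H)
    (hG : ContinuousOn G (Icc c d) ∧ ConcaveOn ℝ (Icc c d) G) {ε : ℝ} (hε : 0 < ε) :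
    ∃ F ∈ saddleNetworks (C a b) (C c d) (Icc a b) (Icc c d) N, ∀ x ∈ Icc a b, ∀ y ∈ Icc c d,
      |(∑ i, e₁ i x * κ i y + ∑ i, e₂ i x * α i y + H x + G y) - F x y| < ε := by
  -- The error budget: `N` products in each of two sums, plus `H` and `G`, make `2 (N + 1)` terms.
  set η := ε / (2 * ((N : ℝ) + 1)) with hη
  have hηpos : 0 < η := by positivity
  have h₁ : ∀ i, ∃ e' ∈ C a b, ∃ n ∈ C c d, (∀ x ∈ Icc a b, 0 ≤ e' x) ∧
      (∀ y ∈ Icc c d, n y ≤ 0) ∧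
      ∀ x ∈ Icc a b, ∀ y ∈ Icc c d, |e₁ i x * κ i y - e' x * -n y| < η := by
    intro i
    obtain ⟨δ, hδ, h⟩ := exists_mul_near isCompact_Icc isCompact_Icc (he₁ i).1 (hκ i).1 hηpos
    obtain ⟨e', he', he'0, hee⟩ := hU.exists_nonneg_near hab (he₁ i).1 (he₁ i).2.1 (he₁ i).2.2 hδ
    -- Networks are convex, so the concave factor is approximated through its negative.
    obtain ⟨n, hn, hn0, hnn⟩ := hU.exists_nonpos_near hcd (hκ i).1.neg (hκ i).2.1.neg
      (fun y hy => neg_nonpos.2 ((hκ i).2.2 y hy)) hδ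
    refine ⟨e', he', n, hn, he'0, hn0, h e' (fun y => -n y) hee fun y hy => ?_⟩
    have := hnn y hy
    rw [Pi.neg_apply, ← abs_neg] at this
    convert this using 2
    ring
  have h₂ : ∀ i, ∃ e' ∈ C a b, ∃ n ∈ C c d, (∀ x ∈ Icc a b, e' x ≤ 0) ∧
      (∀ y ∈ Icc c d, 0 ≤ n y) ∧
      ∀ x ∈ Icc a b, ∀ y ∈ Icc c d, |e₂ i x * α i y - e' x * n y| < η := by
    intro i
    obtain ⟨δ, hδ, h⟩ := exists_mul_near isCompact_Icc isCompact_Icc (he₂ i).1 (hα i).1 hηpos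
    obtain ⟨e', he', he'0, hee⟩ := hU.exists_nonpos_near hab (he₂ i).1 (he₂ i).2.1 (he₂ i).2.2 hδ
    obtain ⟨n, hn, hn0, hnn⟩ := hU.exists_nonneg_near hcd (hα i).1 (hα i).2.1 (hα i).2.2 hδ
    exact ⟨e', he', n, hn, he'0, hn0, h e' n hee hnn⟩
  choose p hp q hq hp0 hq0 hpq using h₁
  choose r hr s hs hr0 hs0 hrs using h₂
  obtain ⟨H', hH', hHH⟩ := hU a b hab H hH.1 hH.2 η hηpos
  obtain ⟨G', hG', hGG⟩ := hU c d hcd (-G) hG.1.neg hG.2.neg η hηpos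
  refine ⟨fun x y => ∑ i, p i x * -q i y + ∑ i, r i x * s i y + H' x + -G' y,
    ⟨p, r, fun i => -q i, s, H', -G', fun i => ⟨hp i, hC a b hab _ (hp i), hp0 i⟩,
      fun i => ⟨hr i, hC a b hab _ (hr i), hr0 i⟩,
      fun i => ⟨by rw [neg_neg]; exact hq i, (hC c d hcd _ (hq i)).neg,
        fun y hy => neg_nonneg.2 (hq0 i y hy)⟩,
      fun i => ⟨hs i, hC c d hcd _ (hs i), hs0 i⟩, ⟨hH', hC a b hab _ hH'⟩,
      ⟨by rwa [neg_neg], (hC c d hcd _ hG').neg⟩, fun x _ y _ => rfl⟩, fun x hx y hy => ?_⟩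
  have s₁ : |∑ i, e₁ i x * κ i y - ∑ i, p i x * -q i y| ≤ N * η := by
    rw [← Finset.sum_sub_distrib]
    refine (Finset.abs_sum_le_sum_abs _ _).trans ?_
    refine (Finset.sum_le_sum fun i _ => (hpq i x hx y hy).le).trans ?_
    simp
  have s₂ : |∑ i, e₂ i x * α i y - ∑ i, r i x * s i y| ≤ N * η := by
    rw [← Finset.sum_sub_distrib]
    refine (Finset.abs_sum_le_sum_abs _ _).trans ?_
    refine (Finset.sum_le_sum fun i _ => (hrs i x hx y hy).le).trans ?_
    simp
  have s₃ := abs_lt.1 (hHH x hx)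
  have s₄ := abs_lt.1 (hGG y hy)
  have htot : 2 * ((N : ℝ) + 1) * η = ε := by
    rw [hη]
    field_simp
  rw [abs_le] at s₁ s₂
  rw [Pi.neg_apply] at s₄
  rw [abs_lt]
  constructor <;> nlinarith [s₁.1, s₁.2, s₂.1, s₂.2, s₃.1, s₃.2, s₄.1, s₄.2]

end Density

/-! ### Assembly of the two signs of the Monge condition -/

theorem saddleNetworks_subset_bilinearSaddleNetworks (CX CY : Set (ℝ → ℝ)) (X Y : Set ℝ) (N : ℕ) :
    saddleNetworks CX CY X Y N ⊆ bilinearSaddleNetworks CX CY X Y N :=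
  fun F hF => ⟨F, hF, 0, fun x _ y _ => by ring⟩

theorem exists_saddleNetwork_near_of_monge {C : NetworkClass} (hC : ConvexityPreserving C)
    (hU : UniversalConvexApproximator C) {a b c d : ℝ} (hab : a ≤ b) (hcd : c ≤ d)
    {f : ℝ → ℝ → ℝ} (hf : IsConvexConcave (Icc a b) (Icc c d) f)
    (hM : MongeNonneg (Icc a b) (Icc c d) f ∨ MongeNonpos (Icc a b) (Icc c d) f)
    {ε : ℝ} (hε : 0 < ε) :
    ∃ N ≥ 1, ∃ F ∈ saddleNetworks (C a b) (C c d) (Icc a b) (Icc c d) N,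
      ∀ x ∈ Icc a b, ∀ y ∈ Icc c d, |f x y - F x y| < ε := by
  have htri : ∀ u v w : ℝ, |u - v| < ε / 2 → |v - w| < ε / 2 → |u - w| < ε := by
    intro u v w h1 h2
    have := abs_sub_le u v w
    linarith
  rcases hM with hM | hM
  · obtain ⟨N, hN, e, κ, M, he, hκ, h⟩ := exists_convex_mul_concave_near hcd hf
      (hM.mongeDifference hab hcd hf.1) (half_pos hε)
    -- The second sum and `H` are approximated from zero, and `G` absorbs the constant `-M`.
    obtain ⟨F, hF, hFn⟩ := exists_saddleNetwork_near hC hU hab hcd (e₂ := fun _ _ => 0)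
      (α := fun _ _ => 0) (H := fun _ => 0) (G := fun _ => -M) he
      (fun _ => ⟨continuousOn_const, convexOn_const _ (convex_Icc _ _), fun _ _ => le_rfl⟩) hκ
      (fun _ => ⟨continuousOn_const, convexOn_const _ (convex_Icc _ _), fun _ _ => le_rfl⟩)
      ⟨continuousOn_const, convexOn_const _ (convex_Icc _ _)⟩
      ⟨continuousOn_const, concaveOn_const _ (convex_Icc _ _)⟩ (half_pos hε)
    refine ⟨N, hN, F, hF, fun x hx y hy => htri _ _ _ (h x hx y hy) ?_⟩
    simpa [sub_eq_add_neg] using hFn x hx y hy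
  -- Swapping the variables and negating keeps the function convex-concave. The mixed condition is
  -- symmetric under the swap, so the negation alone reverses its sign.
  · have hf' : IsConvexConcave (Icc c d) (Icc a b) (fun y x => -f x y) :=
      ⟨(hf.1.comp (f := fun p : ℝ × ℝ => (p.2, p.1)) (by fun_prop)
        fun p hp => ⟨hp.2, hp.1⟩).neg, fun x hx => (hf.2.2 x hx).neg, fun y hy => (hf.2.1 y hy).neg⟩
    obtain ⟨N, hN, e, κ, M, he, hκ, h⟩ := exists_convex_mul_concave_near hab hf'
      ((hM.neg.mongeDifference hab hcd hf.1.neg).swap (convex_Icc _ _)) (half_pos hε)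
    -- After undoing the sign, the concave factors in `x` become the nonpositive convex `-κ i`, and
    -- the convex factors `e i` in `y` take the place of `a⁺`.
    obtain ⟨F, hF, hFn⟩ := exists_saddleNetwork_near hC hU hab hcd (e₁ := fun _ _ => 0)
      (e₂ := fun i x => -κ i x) (κ := fun _ _ => 0) (α := e) (H := fun _ => 0) (G := fun _ => M)
      (fun _ => ⟨continuousOn_const, convexOn_const _ (convex_Icc _ _), fun _ _ => le_rfl⟩)
      (fun i => ⟨(hκ i).1.neg, (hκ i).2.1.neg, fun x hx => neg_nonpos.2 ((hκ i).2.2 x hx)⟩)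
      (fun _ => ⟨continuousOn_const, concaveOn_const _ (convex_Icc _ _), fun _ _ => le_rfl⟩) he
      ⟨continuousOn_const, convexOn_const _ (convex_Icc _ _)⟩
      ⟨continuousOn_const, concaveOn_const _ (convex_Icc _ _)⟩ (half_pos hε)
    refine ⟨N, hN, F, hF, fun x hx y hy => htri _ _ _ ?_ (hFn x hx y hy)⟩
    have := h y hy x hx
    rw [← abs_neg] at this
    convert this using 2
    simp only [mul_zero, Finset.sum_const_zero, neg_mul, Finset.sum_neg_distrib, mul_comm (κ _ _)]
    ring

theorem corollary2 (C : NetworkClass) (hC : IsConcreteFamily C) :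
    ConvexityPreserving C ∧ UniversalConvexApproximator C ∧
    ∀ (a b c d : ℝ), a ≤ b → c ≤ d → ∀ f : ℝ → ℝ → ℝ,
      IsConvexConcave (Icc a b) (Icc c d) f →
      (MongeNonneg (Icc a b) (Icc c d) f ∨ MongeNonpos (Icc a b) (Icc c d) f) →
      ∀ ε > 0,
        (∃ N ≥ 1, ∃ F ∈ saddleNetworks (C a b) (C c d) (Icc a b) (Icc c d) N,
          ∀ x ∈ Icc a b, ∀ y ∈ Icc c d, |f x y - F x y| < ε) ∧
        (∃ N ≥ 1, ∃ F ∈ bilinearSaddleNetworks (C a b) (C c d) (Icc a b) (Icc c d) N,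
          ∀ x ∈ Icc a b, ∀ y ∈ Icc c d, |f x y - F x y| < ε) := by
  refine ⟨hC.convexityPreserving, hC.universalConvexApproximator,
    fun a b c d hab hcd f hf hM ε hε => ?_⟩
  obtain ⟨N, hN, F, hF, h⟩ := exists_saddleNetwork_near_of_monge hC.convexityPreserving
    hC.universalConvexApproximator hab hcd hf hM hε
  exact ⟨⟨N, hN, F, hF, h⟩,
    ⟨N, hN, F, saddleNetworks_subset_bilinearSaddleNetworks _ _ _ _ _ hF, h⟩⟩
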